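/- Let $a:[0,1]\times[0,2\pi]\to\mathbb C$ be such that $x\mapsto a(x,t)$ is Riemann integrable on $[0,1]$ for every $t\in[0,2\pi]$ and $t\mapsto a(x,t)$ belongs to $L^\infty([0,2\pi])$ for every $x\in[0,1]$. Put $$\hat a_k(x)=\frac1{2\pi}\int_0^{2\pi}a(x,t)e^{-ikt}\,dt\qquad(k\in\mathbb Z),$$ assume that $\sum_{k\in\mathbb Z}\|\hat a_k\|_\infty<\infty$, where $\|f\|_\infty=\sup_{x\in[0,1]}|f(x)|$, and let $$T_n(a)=\left[\hat a_{j-i}\!\left(\frac{i+j}{2n+2}\right)\right]_{i,j=0}^{n}$$ be the associated Kac--Murdock--Szegő matrices. Let $$\mathcal R(a)=\bigl\{z\in\mathbb C:\ \operatorname{meas}\{(x,t)\in[0,1]\times[0,2\pi]:|a(x,t)-z|<r\}>0\ \text{ for all } r>0\bigr\}$$ be the essential range of $a$ ($\operatorname{meas}$ is Lebesgue measure), and let the extended range $\mathcal{ER}(a)$ be the union of $\mathcal R(a)$ and all bounded connected components of $\mathbb C\setminus\mathcal R(a)$. Then $\mathcal{ER}(a)$ is a cluster of the eigenvalues of $T_n(a)$: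 for every open set $V\subseteq\mathbb C$ with $\mathcal{ER}(a)\subseteq V$, $$\lim_{n\to\infty}\frac{\mathcal N(V,n)}{n+1}=1,$$ where $\mathcal N(V,n)$ is the number of eigenvalues of $T_n(a)$ in $V$, counted with algebraic multiplicity. In other words, all but $o(n)$ of the $n+1$ eigenvalues of $T_n(a)$ lie in $V$. -/

import Mathlib

open MeasureTheory Set Filter Topology Asymptotics

noncomputable section

namespace KMS

/-- The one-dimensional box `(0, 1]` (its closure is `[0, 1]`), as a box in `Fin 1 → ℝ`. -/
def unitBox : BoxIntegral.Box (Fin 1) where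
  lower := fun _ => 0
  upper := fun _ => 1
  lower_lt_upper := fun _ => zero_lt_one

/-- `f` is Riemann integrable on `[0, 1]`: the Riemann sums over tagged partitions of `[0, 1]`
converge as the mesh tends to `0`. -/
def RiemannIntegrable (f : ℝ → ℂ) : Prop :=
  BoxIntegral.Integrable unitBox BoxIntegral.IntegrationParams.Riemann
    (fun v : Fin 1 → ℝ => f (v 0)) BoxIntegral.BoxAdditiveMap.volume

/-- The `k`-th Fourier coefficient `â_k(x) = (1/2π) ∫₀^{2π} a(x,t) e^{-ikt} dt`. -/
def coeff (a : ℝ → ℝ → ℂ) (k : ℤ) (x : ℝ) : ℂ :=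
  (1 / (2 * Real.pi : ℂ)) *
    ∫ t in (0 : ℝ)..(2 * Real.pi), a x t * Complex.exp (-(Complex.I * k * t))

/-- `∑_{k ∈ ℤ} ‖â_k‖_∞`, where `‖f‖_∞ = sup_{x ∈ [0,1]} |f x|`, as an element of `[0, ∞]`. -/
def decayNorm (a : ℝ → ℝ → ℂ) : ENNReal :=
  ∑' k : ℤ, ⨆ x ∈ Icc (0 : ℝ) 1, ‖coeff a k x‖ₑ

/-- The `(n+1) × (n+1)` matrix `T_n(a) = [â_{j-i}((i+j)/(2n+2))]_{i,j=0}^n`. -/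
def matrix (a : ℝ → ℝ → ℂ) (n : ℕ) : Matrix (Fin (n + 1)) (Fin (n + 1)) ℂ :=
  Matrix.of fun i j =>
    coeff a (((j : ℕ) : ℤ) - ((i : ℕ) : ℤ)) ((((i : ℕ) : ℝ) + ((j : ℕ) : ℝ)) / (2 * (n : ℝ) + 2))

/-- The essential range of `a` on `[0,1] × [0,2π]`. -/
def essRange (a : ℝ → ℝ → ℂ) : Set ℂ :=
  {z | ∀ r : ℝ, 0 < r →
    0 < volume {p : ℝ × ℝ | p ∈ Icc (0 : ℝ) 1 ×ˢ Icc (0 : ℝ) (2 * Real.pi) ∧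
      a p.1 p.2 ∈ Metric.ball z r}}

/-- The extended range: the essential range together with all bounded connected components
of its complement. -/
def extRange (a : ℝ → ℝ → ℂ) : Set ℂ :=
  essRange a ∪
    {z | z ∈ (essRange a)ᶜ ∧ Bornology.IsBounded (connectedComponentIn (essRange a)ᶜ z)}

open Classical in
/-- The number of eigenvalues of `T_n(a)` in `V`, counted with algebraic multiplicity. -/
def eigCount (a : ℝ → ℝ → ℂ) (V : Set ℂ) (n : ℕ) : ℕ :=
  (matrix a n).charpoly.roots.countP (fun z => z ∈ V)

end KMS

end

/-!
Schur's inequality bounds the number of eigenvalues at which a polynomial `p` has modulus at least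
`1` by the squared Frobenius norm of `p(T_n(a))`. That norm obeys a Szegő-type limit theorem: each
row of `T_n(a)` looks locally like the Laurent matrix of `t ↦ a(x, t)`, so `1/(n+1)` times it tends
to `∫∫ |p(a(x, t))|²`, normalised. A point `z₀` outside the extended range lies in an unbounded
component of the complement of the essential range, hence some polynomial is larger than `1` near
`z₀` and smaller than `1` on the essential range; high powers of it show that only `o(n)`
eigenvalues are near `z₀`, and a compactness argument concludes. The row-by-row limit needs only
that almost every `x` is a continuity point of all the `â_k`, which Riemann integrability of
`a(·, t)` provides through the oscillation sums of `â_k` over uniform grids.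
-/

namespace KMS

section Schur

variable {E : Type*} [NormedAddCommGroup E] [InnerProductSpace ℂ E]

theorem orthonormal_finCons {n : ℕ} {v : E} (hv : ‖v‖ = 1) {b : Fin n → (ℂ ∙ v)ᗮ}
    (hb : Orthonormal ℂ b) : Orthonormal ℂ (Fin.cons v fun i => (b i : E) : Fin (n + 1) → E) := by
  have hvb (i) : inner ℂ v (b i : E) = 0 :=
    Submodule.mem_orthogonal_singleton_iff_inner_right.1 (b i).2
  have hbv (i) : inner ℂ (b i : E) v = 0 :=
    Submodule.mem_orthogonal_singleton_iff_inner_left.1 (b i).2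
  have hbb (i j) : inner ℂ (b i : E) (b j : E) = if i = j then (1 : ℂ) else 0 :=
    orthonormal_iff_ite.1 hb i j
  rw [orthonormal_iff_ite]
  refine Fin.cases (Fin.cases ?_ fun j => ?_) fun i => Fin.cases ?_ fun j => ?_
  · simp [inner_self_eq_norm_sq_to_K, hv]
  · simp [hvb, (Fin.succ_ne_zero j).symm]
  · simp [hbv]
  · simp [hbb]

variable [FiniteDimensional ℂ E]

theorem exists_norm_eq_one_hasEigenvector [Nontrivial E] (T : E →ₗ[ℂ] E) :
    ∃ (μ : ℂ) (v : E), ‖v‖ = 1 ∧ T v = μ • v := by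
  obtain ⟨μ, hμ⟩ := Module.End.exists_eigenvalue T
  obtain ⟨w, hw⟩ := hμ.exists_hasEigenvector
  refine ⟨μ, ((‖w‖⁻¹ : ℝ) : ℂ) • w, ?_, by rw [map_smul, hw.apply_eq_smul, smul_comm]⟩
  simp [norm_smul, norm_ne_zero_iff.2 hw.2]

/-- Schur triangulation: split off a unit eigenvector and compress to its orthogonal
complement. -/
theorem exists_isUpperTriangular_toMatrixOrthonormal {n : ℕ} (hn : Module.finrank ℂ E = n)
    (T : E →ₗ[ℂ] E) :
    ∃ b : OrthonormalBasis (Fin n) ℂ E, (LinearMap.toMatrixOrthonormal b T).IsUpperTriangular := by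
  induction n generalizing E with
  | zero => exact ⟨(stdOrthonormalBasis ℂ E).reindex (finCongr hn), fun i => i.elim0⟩
  | succ n ih =>
    have : Nontrivial E := Module.nontrivial_of_finrank_pos (R := ℂ) (by lia)
    obtain ⟨μ, v, hv, hTv⟩ := exists_norm_eq_one_hasEigenvector T
    have hv0 : v ≠ 0 := norm_ne_zero_iff.1 (hv ▸ one_ne_zero)
    have := Fact.mk hn
    obtain ⟨b, hb⟩ := ih (E := (ℂ ∙ v)ᗮ) (Submodule.finrank_orthogonal_span_singleton hv0)
      ((ℂ ∙ v)ᗮ.orthogonalProjectionOnto.toLinearMap ∘ₗ T ∘ₗ (ℂ ∙ v)ᗮ.subtype)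
    have hon := orthonormal_finCons hv b.orthonormal
    have hspan := hon.linearIndependent.span_eq_top_of_card_eq_finrank' (by simp [hn])
    refine ⟨OrthonormalBasis.mk hon hspan.ge, ?_⟩
    intro i j hij
    rw [LinearMap.toMatrixOrthonormal_apply_apply, OrthonormalBasis.coe_mk]
    induction i using Fin.cases with
    | zero => exact absurd hij (Fin.not_lt_zero _)
    | succ i =>
      induction j using Fin.cases with
      | zero =>
        have hbv : inner ℂ (b i : E) v = 0 :=
          Submodule.mem_orthogonal_singleton_iff_inner_left.1 (b i).2
        simp [hTv, inner_smul_right, hbv]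
      | succ j =>
        have := hb (i := i) (j := j) (Fin.succ_lt_succ_iff.1 hij)
        simpa [LinearMap.toMatrixOrthonormal_apply_apply] using this

theorem toMatrixOrthonormal_aeval {ι : Type*} [Fintype ι] [DecidableEq ι]
    (b : OrthonormalBasis ι ℂ E) (T : Module.End ℂ E) (p : Polynomial ℂ) :
    LinearMap.toMatrixOrthonormal b (Polynomial.aeval T p) =
      Polynomial.aeval (LinearMap.toMatrixOrthonormal b T) p :=
  (Polynomial.aeval_algHom_apply (LinearMap.toMatrixAlgEquiv b.toBasis) T p).symm

theorem sum_norm_sq_toMatrixOrthonormal {ι : Type*} [Fintype ι] [DecidableEq ι]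
    (b : OrthonormalBasis ι ℂ E) (S : Module.End ℂ E) :
    ((∑ i, ∑ j, ‖LinearMap.toMatrixOrthonormal b S i j‖ ^ 2 : ℝ) : ℂ) =
      LinearMap.trace ℂ E (S * star S) :=
  calc ((∑ i, ∑ j, ‖LinearMap.toMatrixOrthonormal b S i j‖ ^ 2 : ℝ) : ℂ)
      = (LinearMap.toMatrixOrthonormal b S * star (LinearMap.toMatrixOrthonormal b S)).trace := by
        simp only [Matrix.trace, Matrix.diag_apply, Matrix.mul_apply, Matrix.star_apply,
          RCLike.star_def, Complex.mul_conj', Complex.ofReal_sum, Complex.ofReal_pow]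
    _ = (LinearMap.toMatrixOrthonormal b (S * star S)).trace := by rw [map_mul, map_star]
    _ = LinearMap.trace ℂ E (S * star S) :=
        (LinearMap.trace_eq_matrix_trace ℂ b.toBasis (S * star S)).symm

end Schur

section Triangular

variable {ι R : Type*} [Fintype ι] [LinearOrder ι]

theorem mul_apply_self_of_isUpperTriangular [NonUnitalNonAssocSemiring R] {A B : Matrix ι ι R}
    (hA : A.IsUpperTriangular) (hB : B.IsUpperTriangular) (i : ι) :
    (A * B) i i = A i i * B i i := by
  rw [Matrix.mul_apply, Finset.sum_eq_single i]
  · intro j _ hj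
    rcases lt_or_gt_of_ne hj with h | h
    · rw [hA h, zero_mul]
    · rw [hB h, mul_zero]
  · simp

variable [CommRing R]

theorem isUpperTriangular_aeval {A : Matrix ι ι R} (hA : A.IsUpperTriangular)
    (p : Polynomial R) : (Polynomial.aeval A p).IsUpperTriangular := by
  let S := Matrix.blockTriangularSubalgebra R R (id : ι → ι)
  rw [show Polynomial.aeval A p = Polynomial.aeval (⟨A, hA⟩ : S) p from
    (Polynomial.aeval_subalgebra_coe p S ⟨A, hA⟩).symm]
  exact (Polynomial.aeval (⟨A, hA⟩ : S) p).2

theorem aeval_apply_self_of_isUpperTriangular {A : Matrix ι ι R} (hA : A.IsUpperTriangular)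
    (p : Polynomial R) (i : ι) : Polynomial.aeval A p i i = p.eval (A i i) := by
  induction p using Polynomial.induction_on with
  | C c => simp [Matrix.algebraMap_matrix_apply]
  | add p q hp hq => simp [hp, hq]
  | monomial k c h =>
    rw [pow_succ, ← mul_assoc, map_mul, Polynomial.aeval_X,
      mul_apply_self_of_isUpperTriangular (isUpperTriangular_aeval hA _) hA, h,
      Polynomial.eval_mul_X]

theorem roots_charpoly_of_isUpperTriangular [IsDomain R] {A : Matrix ι ι R}
    (hA : A.IsUpperTriangular) : A.charpoly.roots = Finset.univ.val.map fun i => A i i := by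
  rw [Matrix.charpoly_of_isUpperTriangular A hA, Polynomial.roots_prod _ _
    (Finset.prod_ne_zero_iff.2 fun i _ => Polynomial.X_sub_C_ne_zero _)]
  simp [Multiset.bind_singleton]

end Triangular

section SchurInequality

variable {ι : Type*} [Fintype ι] [DecidableEq ι]

/-- Schur's inequality for `p(M)`: in an orthonormal basis triangulating `M`, the numbers `p(λ)`
are the diagonal entries of `p(M)`. -/
theorem sum_norm_sq_eval_roots_charpoly_le (M : Matrix ι ι ℂ) (p : Polynomial ℂ) :
    (M.charpoly.roots.map fun z => ‖p.eval z‖ ^ 2).sum ≤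
      ∑ i, ∑ j, ‖Polynomial.aeval M p i j‖ ^ 2 := by
  set e := EuclideanSpace.basisFun ι ℂ
  set T := (LinearMap.toMatrixOrthonormal e).symm M
  obtain ⟨b, hb⟩ := exists_isUpperTriangular_toMatrixOrthonormal rfl T
  set R := LinearMap.toMatrixOrthonormal b T
  have hM : LinearMap.toMatrixOrthonormal e T = M := StarAlgEquiv.apply_symm_apply _ M
  have hfrob : ∑ i, ∑ j, ‖LinearMap.toMatrixOrthonormal b (Polynomial.aeval T p) i j‖ ^ 2 =
      ∑ i, ∑ j, ‖LinearMap.toMatrixOrthonormal e (Polynomial.aeval T p) i j‖ ^ 2 :=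
    Complex.ofReal_injective <| (sum_norm_sq_toMatrixOrthonormal b _).trans
      (sum_norm_sq_toMatrixOrthonormal e _).symm
  rw [toMatrixOrthonormal_aeval, toMatrixOrthonormal_aeval, hM] at hfrob
  have hcharpoly : M.charpoly = R.charpoly :=
    calc M.charpoly = (LinearMap.toMatrix e.toBasis e.toBasis T).charpoly :=
          congrArg Matrix.charpoly hM.symm
      _ = T.charpoly := LinearMap.charpoly_toMatrix T e.toBasis
      _ = R.charpoly := (LinearMap.charpoly_toMatrix T b.toBasis).symm
  calc (M.charpoly.roots.map fun z => ‖p.eval z‖ ^ 2).sum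
      = ∑ i, ‖Polynomial.aeval R p i i‖ ^ 2 := by
        simp only [hcharpoly, roots_charpoly_of_isUpperTriangular hb, Multiset.map_map,
          Function.comp_def, aeval_apply_self_of_isUpperTriangular hb, Finset.sum_map_val]
    _ ≤ ∑ i, ∑ j, ‖Polynomial.aeval R p i j‖ ^ 2 :=
        Finset.sum_le_sum fun i _ => Finset.single_le_sum
          (f := fun j => ‖Polynomial.aeval R p i j‖ ^ 2) (fun j _ => by positivity)
          (Finset.mem_univ i)
    _ = ∑ i, ∑ j, ‖Polynomial.aeval M p i j‖ ^ 2 := hfrob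

open Classical in
theorem countP_roots_charpoly_le (M : Matrix ι ι ℂ) {p : Polynomial ℂ} {U : Set ℂ}
    (hU : ∀ z ∈ U, 1 ≤ ‖p.eval z‖) :
    (M.charpoly.roots.countP (· ∈ U) : ℝ) ≤ ∑ i, ∑ j, ‖Polynomial.aeval M p i j‖ ^ 2 := by
  refine le_trans ?_ (sum_norm_sq_eval_roots_charpoly_le M p)
  induction M.charpoly.roots using Multiset.induction with
  | empty => simp
  | cons z s ih =>
    by_cases hz : z ∈ U
    · have := one_le_pow₀ (n := 2) (hU z hz)
      simp only [Multiset.countP_cons_of_pos _ hz, Multiset.map_cons, Multiset.sum_cons]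
      push_cast
      linarith
    · simp only [Multiset.countP_cons_of_neg _ hz, Multiset.map_cons, Multiset.sum_cons]
      linarith [sq_nonneg ‖p.eval z‖]

end SchurInequality

section PolynomialSeparation

variable {K : Set ℂ} [CompactSpace K] {z₀ : ℂ}

/-- Passing from `C(K, ℂ)` to the closed subalgebra generated by the coordinate function only adds
bounded components of `Kᶜ` to the spectrum of that function. -/
theorem exists_mem_closure_polynomialFunctions_sub_mul_eq_one
    (hz₀ : ¬ Bornology.IsBounded (connectedComponentIn Kᶜ z₀)) :
    ∃ u ∈ (polynomialFunctions K).topologicalClosure, ∀ z : K, (z₀ - z) * u z = 1 := by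
  let S := (polynomialFunctions K).topologicalClosure
  have : IsClosed (S : Set C(K, ℂ)) := Subalgebra.isClosed_topologicalClosure _
  let f : S := ⟨Polynomial.toContinuousMapOn Polynomial.X K,
    Subalgebra.le_topologicalClosure _ ⟨Polynomial.X, by simp⟩⟩
  have hspec : spectrum ℂ (f : C(K, ℂ)) = K := by
    rw [ContinuousMap.spectrum_eq_range]
    ext z
    simp [f]
  have hf : z₀ ∉ spectrum ℂ f := fun h => hz₀ <|
    hspec ▸ Subalgebra.spectrum_isBounded_connectedComponentIn S f h
  obtain ⟨u, hu⟩ := (spectrum.notMem_iff.1 hf).exists_right_inv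
  refine ⟨u, u.2, fun z => ?_⟩
  simpa [f] using congrArg (fun g : S => (g : C(K, ℂ)) z) hu

/-- If a polynomial `q` is uniformly close to `(z₀ - z)⁻¹` on `K`, then `1 - (z₀ - z) * q` is
small on `K`. -/
theorem exists_polynomial_eval_eq_one_norm_le
    (hz₀ : ¬ Bornology.IsBounded (connectedComponentIn Kᶜ z₀)) {ε : ℝ} (hε : 0 < ε) :
    ∃ p : Polynomial ℂ, p.eval z₀ = 1 ∧ ∀ z ∈ K, ‖p.eval z‖ ≤ ε := by
  obtain ⟨u, hu, hu1⟩ := exists_mem_closure_polynomialFunctions_sub_mul_eq_one hz₀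
  let g : C(K, ℂ) := ⟨fun z => z₀ - z, by fun_prop⟩
  obtain ⟨_, ⟨q, -, rfl⟩, hq⟩ := Metric.mem_closure_iff.1 hu (ε / (‖g‖ + 1)) (by positivity)
  refine ⟨1 - (Polynomial.C z₀ - Polynomial.X) * q, by simp, fun z hz => ?_⟩
  have hq' : ‖u ⟨z, hz⟩ - q.eval z‖ ≤ ε / (‖g‖ + 1) := by
    rw [dist_eq_norm] at hq
    exact ((u - Polynomial.toContinuousMapOn q K).norm_coe_le_norm ⟨z, hz⟩).trans hq.le
  have hg : ‖z₀ - z‖ ≤ ‖g‖ + 1 := (g.norm_coe_le_norm ⟨z, hz⟩).trans (by linarith)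
  have heval : (1 - (Polynomial.C z₀ - Polynomial.X) * q).eval z =
      (z₀ - z) * (u ⟨z, hz⟩ - q.eval z) := by
    simp [mul_sub, hu1 ⟨z, hz⟩]
  calc ‖(1 - (Polynomial.C z₀ - Polynomial.X) * q).eval z‖
      = ‖z₀ - z‖ * ‖u ⟨z, hz⟩ - q.eval z‖ := by rw [heval, norm_mul]
    _ ≤ (‖g‖ + 1) * (ε / (‖g‖ + 1)) := by gcongr
    _ = ε := by field_simp

end PolynomialSeparation

section GridOscillation

/-- The `i`-th of the `m` closed intervals of equal length into which `[0, 1]` is divided. -/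
def gridCell (m i : ℕ) : Set ℝ :=
  Icc ((i : ℝ) / m) (((i : ℝ) + 1) / m)

/-- The points `x i` are tags for the partition of `[0, 1]` into `m` intervals of equal length. -/
def IsGridTag {m : ℕ} (x : Fin m → ℝ) : Prop :=
  ∀ i : Fin m, x i ∈ gridCell m i

/-- The mean over the cells of the grids of the distance between two values of `f` on the same cell
tends to `0`, however the two points are chosen. -/
def HasVanishingGridOscillation {X : Type*} [PseudoMetricSpace X] (f : ℝ → X) : Prop :=
  ∀ x y : ∀ m, Fin m → ℝ, (∀ m, IsGridTag (x m)) → (∀ m, IsGridTag (y m)) →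
    Tendsto (fun m : ℕ => (m : ℝ)⁻¹ * ∑ i, dist (f (x m i)) (f (y m i))) atTop (𝓝 0)

theorem nonempty_gridCell (m i : ℕ) : (gridCell m i).Nonempty :=
  nonempty_Icc.2 (by gcongr; linarith)

theorem gridCell_subset_Icc {m : ℕ} (i : Fin m) : gridCell m i ⊆ Icc 0 1 := by
  have hm : (0 : ℝ) < m := by exact_mod_cast i.pos
  refine Icc_subset_Icc (by positivity) ((div_le_one hm).2 ?_)
  exact_mod_cast i.isLt

theorem volume_gridCell (m i : ℕ) : volume (gridCell m i) = ENNReal.ofReal (m : ℝ)⁻¹ := by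
  rw [gridCell, Real.volume_Icc, ← sub_div, add_sub_cancel_left, one_div]

theorem exists_gridCell_mem_nhds {w : ℝ} (hw : w ∈ Ioo (0 : ℝ) 1) (hirr : Irrational w) {m : ℕ}
    (hm : m ≠ 0) : ∃ i : Fin m, gridCell m i ∈ 𝓝 w := by
  have hm' : (0 : ℝ) < m := by exact_mod_cast hm.bot_lt
  have hle : (⌊m * w⌋₊ : ℝ) ≤ m * w := Nat.floor_le (mul_nonneg hm'.le hw.1.le)
  have hlt : m * w < ⌊m * w⌋₊ + 1 := Nat.lt_floor_add_one _
  have hne : (⌊m * w⌋₊ : ℝ) / m ≠ w := fun h => hirr ⟨(⌊m * w⌋₊ : ℚ) / m, by push_cast; exact h⟩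
  have him : ⌊m * w⌋₊ < m := by
    rw [Nat.floor_lt (mul_nonneg hm'.le hw.1.le)]
    exact mul_lt_of_lt_one_right hm' hw.2
  exact ⟨⟨_, him⟩, Icc_mem_nhds (((div_le_iff₀' hm').2 hle).lt_of_ne hne)
    ((lt_div_iff₀' hm').2 hlt)⟩

variable {X : Type*} [PseudoMetricSpace X] {f : ℝ → X}

theorem exists_isGridTag_lt_dist (f : ℝ → X) (ε : ℝ) (m : ℕ) :
    ∃ x y : Fin m → ℝ, IsGridTag x ∧ IsGridTag y ∧ ∀ i : Fin m, ∀ u ∈ gridCell m i,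
      ∀ v ∈ gridCell m i, ε < dist (f u) (f v) → ε < dist (f (x i)) (f (y i)) := by
  have hcell (i : Fin m) : ∃ x ∈ gridCell m i, ∃ y ∈ gridCell m i, ∀ u ∈ gridCell m i,
      ∀ v ∈ gridCell m i, ε < dist (f u) (f v) → ε < dist (f x) (f y) := by
    by_cases h : ∃ x ∈ gridCell m i, ∃ y ∈ gridCell m i, ε < dist (f x) (f y)
    · obtain ⟨x, hx, y, hy, hxy⟩ := h
      exact ⟨x, hx, y, hy, fun _ _ _ _ _ => hxy⟩
    · obtain ⟨x, hx⟩ := nonempty_gridCell m i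
      exact ⟨x, hx, x, hx, fun u hu v hv huv => absurd ⟨u, hu, v, hv, huv⟩ h⟩
  choose x hx y hy hxy using hcell
  exact ⟨x, y, hx, hy, hxy⟩

theorem exists_lt_dist_of_lt_oscillation {ε w : ℝ} {U : Set ℝ} (hU : U ∈ 𝓝 w)
    (hw : ENNReal.ofReal ε < oscillation f w) : ∃ u ∈ U, ∃ v ∈ U, ε < dist (f u) (f v) := by
  by_contra! h
  refine hw.not_ge ((biInf_le Metric.ediam (image_mem_map hU)).trans (Metric.ediam_le ?_))
  rintro _ ⟨u, hu, rfl⟩ _ ⟨v, hv, rfl⟩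
  rw [edist_dist]
  exact ENNReal.ofReal_le_ofReal (h u hu v hv)

theorem volume_lt_oscillation_le {ε : ℝ} (hε : 0 < ε) {m : ℕ} (hm : m ≠ 0) {x y : Fin m → ℝ}
    (hxy : ∀ i : Fin m, ∀ u ∈ gridCell m i, ∀ v ∈ gridCell m i,
      ε < dist (f u) (f v) → ε < dist (f (x i)) (f (y i))) :
    volume {w ∈ Ioo (0 : ℝ) 1 | Irrational w ∧ ENNReal.ofReal ε < oscillation f w} ≤
      ENNReal.ofReal (ε⁻¹ * ((m : ℝ)⁻¹ * ∑ i, dist (f (x i)) (f (y i)))) := by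
  let s : Finset (Fin m) := {i | ε < dist (f (x i)) (f (y i))}
  have hcover : {w ∈ Ioo (0 : ℝ) 1 | Irrational w ∧ ENNReal.ofReal ε < oscillation f w} ⊆
      ⋃ i ∈ s, gridCell m i := by
    rintro w ⟨hw, hirr, hosc⟩
    obtain ⟨i, hi⟩ := exists_gridCell_mem_nhds hw hirr hm
    obtain ⟨u, hu, v, hv, huv⟩ := exists_lt_dist_of_lt_oscillation hi hosc
    exact mem_iUnion₂.2 ⟨i, by simpa [s] using hxy i u hu v hv huv, mem_of_mem_nhds hi⟩
  have hcard : s.card * ε ≤ ∑ i, dist (f (x i)) (f (y i)) := by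
    rw [← nsmul_eq_mul, ← Finset.sum_const]
    exact (Finset.sum_le_sum fun i hi => (Finset.mem_filter.1 hi).2.le).trans
      (Finset.sum_le_univ_sum_of_nonneg fun _ => dist_nonneg)
  calc volume {w ∈ Ioo (0 : ℝ) 1 | Irrational w ∧ ENNReal.ofReal ε < oscillation f w}
      ≤ ∑ i ∈ s, volume (gridCell m i) :=
        (measure_mono hcover).trans (measure_biUnion_finset_le _ _)
    _ = ENNReal.ofReal ((m : ℝ)⁻¹ * s.card) := by
        rw [mul_comm, ENNReal.ofReal_mul (by positivity)]
        simp only [volume_gridCell, Finset.sum_const, nsmul_eq_mul, ENNReal.ofReal_natCast]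
    _ ≤ ENNReal.ofReal (ε⁻¹ * ((m : ℝ)⁻¹ * ∑ i, dist (f (x i)) (f (y i)))) := by
        refine ENNReal.ofReal_le_ofReal ?_
        rw [mul_left_comm]
        gcongr
        rwa [le_inv_mul_iff₀' hε]

theorem HasVanishingGridOscillation.volume_lt_oscillation_eq_zero
    (hf : HasVanishingGridOscillation f) {ε : ℝ} (hε : 0 < ε) :
    volume {w ∈ Ioo (0 : ℝ) 1 | Irrational w ∧ ENNReal.ofReal ε < oscillation f w} = 0 := by
  choose x y hx hy hxy using exists_isGridTag_lt_dist f ε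
  have hlim := ENNReal.tendsto_ofReal ((hf x y hx hy).const_mul ε⁻¹)
  rw [mul_zero, ENNReal.ofReal_zero] at hlim
  refine le_antisymm (ge_of_tendsto hlim ?_) bot_le
  filter_upwards [eventually_ne_atTop 0] with m hm
  exact volume_lt_oscillation_le hε hm (hxy m)

theorem HasVanishingGridOscillation.ae_continuousAt (hf : HasVanishingGridOscillation f) :
    ∀ᵐ w ∂volume.restrict (Ioo (0 : ℝ) 1), ContinuousAt f w := by
  have hosc : ∀ᵐ w : ℝ, ∀ n : ℕ, ¬(w ∈ Ioo (0 : ℝ) 1 ∧ Irrational w ∧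
      ENNReal.ofReal (1 / (n + 1)) < oscillation f w) :=
    ae_all_iff.2 fun n => measure_eq_zero_iff_ae_notMem.1
      (hf.volume_lt_oscillation_eq_zero (Nat.one_div_pos_of_nat (n := n)))
  have hirr : ∀ᵐ w : ℝ, Irrational w := (countable_range ((↑) : ℚ → ℝ)).ae_notMem _
  rw [ae_restrict_iff' measurableSet_Ioo]
  filter_upwards [hosc, hirr] with w hw hwirr hw01
  rw [← Oscillation.eq_zero_iff_continuousAt]
  by_contra h0
  have hlim := ENNReal.tendsto_ofReal (tendsto_one_div_add_atTop_nhds_zero_nat (𝕜 := ℝ))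
  rw [ENNReal.ofReal_zero] at hlim
  obtain ⟨n, hn⟩ := (hlim.eventually (gt_mem_nhds (pos_iff_ne_zero.2 h0))).exists
  exact hw n ⟨hw01, hwirr, hn⟩

end GridOscillation

section RiemannSums

theorem unitPartition_box_le_unitBox_iff {m : ℕ} [NeZero m] {ν : Fin 1 → ℤ} :
    BoxIntegral.unitPartition.box m ν ≤ unitBox ↔ 0 ≤ ν 0 ∧ ν 0 < m := by
  have hm : (0 : ℝ) < m := by exact_mod_cast NeZero.pos m
  rw [BoxIntegral.Box.le_iff_bounds]
  simp only [Pi.le_def, unitBox, BoxIntegral.unitPartition.box_lower,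
    BoxIntegral.unitPartition.box_upper, Fin.forall_fin_one]
  rw [le_div_iff₀ hm, zero_mul, div_le_one hm]
  exact and_congr (by norm_cast) (by norm_cast)

/-- The box `(i / m, (i + 1) / m]` in the form in which `BoxIntegral` handles it. -/
noncomputable def gridBox (m : ℕ) [NeZero m] : Fin m ↪ BoxIntegral.Box (Fin 1) where
  toFun i := BoxIntegral.unitPartition.box m fun _ => (i : ℤ)
  inj' i j h := by
    simpa [Fin.ext_iff] using congrFun (BoxIntegral.unitPartition.box_injective m h) 0

theorem gridBox_apply (m : ℕ) [NeZero m] (i : Fin m) :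
    gridBox m i = BoxIntegral.unitPartition.box m fun _ => (i : ℤ) := rfl

/-- The partition of the unit box into the boxes `gridBox m i`, the `i`-th box being tagged by
`x i`; the projection to `[0, 1]` makes this a tagged prepartition for arbitrary `x`. -/
noncomputable def gridPartition {m : ℕ} [NeZero m] (x : Fin m → ℝ) :
    BoxIntegral.TaggedPrepartition unitBox where
  toPrepartition := (BoxIntegral.unitPartition.prepartition m unitBox).toPrepartition
  tag J := fun _ => projIcc 0 1 zero_le_one (x (Fin.ofNat m ⌊m * J.lower 0⌋₊))
  tag_mem_Icc J := by
    rw [BoxIntegral.Box.Icc_def]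
    exact ⟨fun _ => (projIcc 0 1 zero_le_one _).2.1, fun _ => (projIcc 0 1 zero_le_one _).2.2⟩

theorem gridPartition_boxes {m : ℕ} [NeZero m] (x : Fin m → ℝ) :
    (gridPartition x).boxes = Finset.univ.map (gridBox m) := by
  ext J
  refine BoxIntegral.unitPartition.mem_prepartition_iff.trans ?_
  simp only [BoxIntegral.unitPartition.mem_admissibleIndex_iff, unitPartition_box_le_unitBox_iff,
    Finset.mem_map, Finset.mem_univ, true_and]
  constructor
  · rintro ⟨ν, ⟨h0, h1⟩, rfl⟩
    refine ⟨⟨(ν 0).toNat, by lia⟩, congrArg (BoxIntegral.unitPartition.box m) (funext fun j => ?_)⟩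
    rw [Subsingleton.elim j 0]
    exact Int.toNat_of_nonneg h0
  · rintro ⟨i, rfl⟩
    exact ⟨_, ⟨by simp, by simp⟩, rfl⟩

theorem gridPartition_isPartition {m : ℕ} [NeZero m] (x : Fin m → ℝ) :
    (gridPartition x).IsPartition :=
  BoxIntegral.unitPartition.prepartition_isPartition m
    ⟨fun _ => 0, fun _ => 1, by simp [unitBox], by simp [unitBox]⟩

variable {m : ℕ} [NeZero m] {x : Fin m → ℝ}

theorem gridPartition_tag_gridBox (hx : IsGridTag x) (i : Fin m) :
    (gridPartition x).tag (gridBox m i) = fun _ => x i := by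
  have hlower : ⌊(m : ℝ) * (gridBox m i).lower 0⌋₊ = i := by
    have hm : (m : ℝ) ≠ 0 := by exact_mod_cast NeZero.ne m
    rw [gridBox_apply, BoxIntegral.unitPartition.box_lower, Int.cast_natCast, mul_div_cancel₀ _ hm,
      Nat.floor_natCast]
  funext j
  change (projIcc 0 1 zero_le_one (x (Fin.ofNat m ⌊m * (gridBox m i).lower 0⌋₊)) : ℝ) = x i
  rw [hlower, Fin.ofNat_eq_cast, Fin.cast_val_eq_self,
    projIcc_of_mem _ (gridCell_subset_Icc i (hx i))]

theorem integralSum_gridPartition (hx : IsGridTag x) (f : ℝ → ℂ) :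
    BoxIntegral.integralSum (fun v : Fin 1 → ℝ => f (v 0)) BoxIntegral.BoxAdditiveMap.volume
      (gridPartition x) = (m : ℂ)⁻¹ * ∑ i, f (x i) := by
  rw [BoxIntegral.integralSum, gridPartition_boxes, Finset.sum_map, Finset.mul_sum]
  refine Finset.sum_congr rfl fun i _ => ?_
  rw [gridPartition_tag_gridBox hx, BoxIntegral.BoxAdditiveMap.volume_apply]
  simp [gridBox_apply, BoxIntegral.unitPartition.box_lower, BoxIntegral.unitPartition.box_upper,
    add_div]

theorem isHenstock_gridPartition (hx : IsGridTag x) : (gridPartition x).IsHenstock := by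
  intro J hJ
  rw [← BoxIntegral.TaggedPrepartition.mem_toPrepartition,
    ← BoxIntegral.Prepartition.mem_boxes, gridPartition_boxes, Finset.mem_map] at hJ
  obtain ⟨i, -, rfl⟩ := hJ
  rw [gridPartition_tag_gridBox hx, BoxIntegral.Box.Icc_def]
  exact ⟨fun _ => (hx i).1, fun _ => (hx i).2⟩

theorem memBaseSet_gridPartition (hx : IsGridTag x) {r : (Fin 1 → ℝ) → Ioi (0 : ℝ)}
    (hr : ∀ v, 1 / (m : ℝ) ≤ r v) :
    BoxIntegral.IntegrationParams.Riemann.MemBaseSet unitBox 0 r (gridPartition x) := by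
  refine ⟨fun J hJ v hv => ?_, fun _ => isHenstock_gridPartition hx,
    fun h => absurd h (by decide), fun h => absurd h (by decide)⟩
  have htag := isHenstock_gridPartition hx J hJ
  rw [← BoxIntegral.TaggedPrepartition.mem_toPrepartition,
    ← BoxIntegral.Prepartition.mem_boxes, gridPartition_boxes, Finset.mem_map] at hJ
  obtain ⟨i, -, rfl⟩ := hJ
  rw [Metric.mem_closedBall]
  exact (Metric.dist_le_diam_of_mem (BoxIntegral.Box.isBounded_Icc _) hv htag).trans
    ((BoxIntegral.unitPartition.diam_boxIcc m _).trans (hr _))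

end RiemannSums

section RiemannIntegrable

variable {f : ℝ → ℂ} {x y : ∀ m, Fin m → ℝ}

theorem RiemannIntegrable.tendsto_mean (hf : RiemannIntegrable f) (hx : ∀ m, IsGridTag (x m)) :
    Tendsto (fun m : ℕ => (m : ℂ)⁻¹ * ∑ i, f (x m i)) atTop
      (𝓝 (BoxIntegral.integral unitBox BoxIntegral.IntegrationParams.Riemann
        (fun v => f (v 0)) BoxIntegral.BoxAdditiveMap.volume)) := by
  rw [Metric.tendsto_nhds]
  intro ε hε
  let r := BoxIntegral.Integrable.convergenceR hf (ε / 2) 0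
  have hr : ∀ v, r v = r 0 := BoxIntegral.Integrable.convergenceR_cond hf (ε / 2) 0 rfl
  have hr0 : (0 : ℝ) < r 0 := (r 0).2
  filter_upwards [eventually_ne_atTop 0,
    tendsto_one_div_atTop_nhds_zero_nat.eventually (ge_mem_nhds hr0)] with m hm0 hm
  have : NeZero m := ⟨hm0⟩
  rw [← integralSum_gridPartition (hx m)]
  exact (BoxIntegral.Integrable.dist_integralSum_integral_le_of_memBaseSet hf (half_pos hε)
    (memBaseSet_gridPartition (hx m) fun v => hm.trans_eq (congrArg Subtype.val (hr v).symm))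
    (gridPartition_isPartition _)).trans_lt (half_lt_self hε)

/-- Swapping `x m i` and `y m i` where necessary makes every `L (f (x m i) - f (y m i))`
nonnegative, so that the absolute values may be dropped. -/
theorem RiemannIntegrable.tendsto_mean_abs_sub (hf : RiemannIntegrable f)
    (hx : ∀ m, IsGridTag (x m)) (hy : ∀ m, IsGridTag (y m)) (L : ℂ →L[ℝ] ℝ) :
    Tendsto (fun m : ℕ => (m : ℝ)⁻¹ * ∑ i, |L (f (x m i) - f (y m i))|) atTop (𝓝 0) := by
  have hswap (m : ℕ) (i : Fin m) : ∃ p ∈ gridCell m i, ∃ q ∈ gridCell m i,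
      |L (f (x m i) - f (y m i))| = L (f p - f q) := by
    rcases le_total 0 (L (f (x m i) - f (y m i))) with h | h
    · exact ⟨_, hx m i, _, hy m i, abs_of_nonneg h⟩
    · exact ⟨_, hy m i, _, hx m i, by rw [abs_of_nonpos h, ← map_neg, neg_sub]⟩
  choose p hp q hq hpq using hswap
  have hlim := (L.continuous.tendsto _).comp ((hf.tendsto_mean hp).sub (hf.tendsto_mean hq))
  rw [sub_self, map_zero] at hlim
  refine hlim.congr fun m => ?_
  have hsmul : (m : ℂ)⁻¹ * ∑ i, f (p m i) - (m : ℂ)⁻¹ * ∑ i, f (q m i) =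
      (m : ℝ)⁻¹ • ∑ i, (f (p m i) - f (q m i)) := by
    rw [← mul_sub, ← Finset.sum_sub_distrib, Complex.real_smul]
    push_cast
    rfl
  simp only [Function.comp_apply, hsmul, map_smul, map_sum, smul_eq_mul, hpq]

theorem RiemannIntegrable.hasVanishingGridOscillation (hf : RiemannIntegrable f) :
    HasVanishingGridOscillation f := by
  intro x y hx hy
  have hlim := (hf.tendsto_mean_abs_sub hx hy Complex.reCLM).add
    (hf.tendsto_mean_abs_sub hx hy Complex.imCLM)
  rw [add_zero] at hlim
  refine squeeze_zero (fun m => by positivity) (fun m => ?_) hlim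
  rw [← mul_add, ← Finset.sum_add_distrib]
  gcongr with i
  rw [dist_eq_norm]
  exact Complex.norm_le_abs_re_add_abs_im _

end RiemannIntegrable

section FourierSeries

open AddCircle

variable {T : ℝ} {c : ℤ → ℂ}

/-- The trigonometric series `∑ k, c k • fourier k` as a continuous function on the circle; a junk
value unless `c` is absolutely summable. -/
noncomputable def circleSeries (c : ℤ → ℂ) : C(AddCircle T, ℂ) :=
  ∑' k : ℤ, c k • fourier k

variable [Fact (0 < T)]

theorem hasSum_circleSeries (hc : Summable fun k => ‖c k‖) :
    HasSum (fun k => c k • fourier k) (circleSeries c : C(AddCircle T, ℂ)) := by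
  refine (Summable.of_norm ?_).hasSum
  simpa only [norm_smul, fourier_norm, mul_one] using hc

theorem norm_circleSeries_le (hc : Summable fun k => ‖c k‖) :
    ‖(circleSeries c : C(AddCircle T, ℂ))‖ ≤ ∑' k, ‖c k‖ := by
  refine tsum_of_norm_bounded hc.hasSum fun k => ?_
  rw [norm_smul, fourier_norm, mul_one]

theorem hasSum_fourierCoeff {ι : Type*} {F : ι → C(AddCircle T, ℂ)} {G : C(AddCircle T, ℂ)}
    (h : HasSum F G) (k : ℤ) :
    HasSum (fun i => fourierCoeff (F i) k) (fourierCoeff G k) := by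
  have hinner (g : C(AddCircle T, ℂ)) :
      fourierCoeff g k = innerSL ℂ (fourierLp 2 k) (g.toLp 2 haarAddCircle ℂ) := by
    rw [← fourierCoeff_toLp, ← fourierBasis_repr, fourierBasis.repr_apply_apply, coe_fourierBasis,
      innerSL_apply_apply]
  simp only [hinner]
  exact (h.mapL (ContinuousMap.toLp 2 haarAddCircle ℂ)).mapL (innerSL ℂ (fourierLp 2 k))

theorem fourierCoeff_mul_fourier (g : C(AddCircle T, ℂ)) (l k : ℤ) :
    fourierCoeff (g * fourier l : C(AddCircle T, ℂ)) k = fourierCoeff g (k - l) := by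
  refine integral_congr_ae (ae_of_all _ fun θ => ?_)
  change fourier (-k) θ * (g θ * fourier l θ) = fourier (-(k - l)) θ * g θ
  rw [neg_sub, sub_eq_add_neg, fourier_add]
  ring

theorem hasSum_fourierCoeff_mul_circleSeries (g : C(AddCircle T, ℂ))
    (hc : Summable fun k => ‖c k‖) (k : ℤ) :
    HasSum (fun l => fourierCoeff g l * c (k - l))
      (fourierCoeff (g * circleSeries c : C(AddCircle T, ℂ)) k) := by
  have h := hasSum_fourierCoeff ((hasSum_circleSeries hc).mul_left g) k
  rw [← (Equiv.subLeft k).hasSum_iff] at h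
  convert h using 2 with l
  simp only [Function.comp_apply, Equiv.subLeft_apply, mul_smul_comm]
  rw [ContinuousMap.coe_smul, fourierCoeff.const_smul,
    fourierCoeff_mul_fourier, sub_sub_cancel, smul_eq_mul, mul_comm]

theorem hasSum_norm_sq_fourierCoeff (g : C(AddCircle T, ℂ)) :
    HasSum (fun k => ‖fourierCoeff g k‖ ^ 2) (∫ θ, ‖g θ‖ ^ 2 ∂haarAddCircle) := by
  have h := hasSum_sq_fourierCoeff (g.toLp 2 haarAddCircle ℂ)
  simp only [fourierCoeff_toLp] at h
  convert h using 1
  refine integral_congr_ae ?_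
  filter_upwards [g.coeFn_toLp (p := 2) (𝕜 := ℂ) haarAddCircle] with θ hθ
  rw [hθ]

theorem ae_eq_circleSeries_fourierCoeff {f : AddCircle T → ℂ}
    (hf : MemLp f 2 (haarAddCircle (T := T)))
    (hc : Summable fun k => ‖fourierCoeff f k‖) :
    f =ᵐ[haarAddCircle] ⇑(circleSeries (fourierCoeff f) : C(AddCircle T, ℂ)) := by
  have hf_sum := hasSum_fourier_series_L2 hf.toLp
  have hc_sum :=
    (hasSum_circleSeries hc).mapL (ContinuousMap.toLp (E := ℂ) 2 (haarAddCircle (T := T)) ℂ)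
  simp only [fourierCoeff_congr_ae hf.coeFn_toLp] at hf_sum
  simp only [map_smul] at hc_sum
  refine hf.coeFn_toLp.symm.trans ?_
  rw [hf_sum.unique hc_sum]
  exact ContinuousMap.coeFn_toLp _ _

end FourierSeries

section Symbol

instance fact_two_pi_pos : Fact (0 < 2 * Real.pi) := ⟨Real.two_pi_pos⟩

theorem fourier_two_pi_coe_apply (k : ℤ) (t : ℝ) :
    fourier k (t : AddCircle (2 * Real.pi)) = Complex.exp (Complex.I * k * t) := by
  rw [fourier_coe_apply]
  congr 1
  have : (Real.pi : ℂ) ≠ 0 := by exact_mod_cast Real.pi_ne_zero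
  push_cast
  field_simp

theorem coeff_eq_fourierCoeff (a : ℝ → ℝ → ℂ) (k : ℤ) (x : ℝ) :
    coeff a k x = fourierCoeff (AddCircle.liftIoc (2 * Real.pi) 0 (a x)) k := by
  rw [fourierCoeff_eq_intervalIntegral _ _ 0, zero_add, coeff, Complex.real_smul]
  congr 1
  · push_cast
    rfl
  · simp only [intervalIntegral.integral_of_le Real.two_pi_pos.le]
    refine setIntegral_congr_fun measurableSet_Ioc fun t ht => ?_
    rw [AddCircle.liftIoc_coe_apply (by simpa only [zero_add] using ht), fourier_two_pi_coe_apply,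
      smul_eq_mul, mul_comm]
    push_cast
    ring_nf

variable {a : ℝ → ℝ → ℂ} {x : ℝ}

/-- The sum of the Fourier series of `a x`: the continuous representative of the symbol at `x`. -/
noncomputable def symbol (a : ℝ → ℝ → ℂ) (x : ℝ) : C(AddCircle (2 * Real.pi), ℂ) :=
  circleSeries fun k => coeff a k x

theorem ae_eq_symbol (hf : MemLp (a x) 2 (volume.restrict (Icc 0 (2 * Real.pi))))
    (hc : Summable fun k => ‖coeff a k x‖) :
    ∀ᵐ t : ℝ ∂volume.restrict (Icc 0 (2 * Real.pi)), a x t = symbol a x t := by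
  have hf_Ioc : MemLp (a x) 2 (volume.restrict (Ioc 0 (0 + 2 * Real.pi))) := by
    rwa [zero_add, restrict_Ioc_eq_restrict_Icc]
  simp only [coeff_eq_fourierCoeff] at hc
  have hae := ae_eq_circleSeries_fourierCoeff hf_Ioc.memLp_liftIoc.haarAddCircle hc
  have hae_vol : AddCircle.liftIoc (2 * Real.pi) 0 (a x) =ᵐ[volume] symbol a x := by
    rw [AddCircle.volume_eq_smul_haarAddCircle]
    simp only [symbol, coeff_eq_fourierCoeff]
    exact Measure.ae_smul_measure hae _
  rw [← restrict_Ioc_eq_restrict_Icc]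
  have hae_Ioc :=
    (AddCircle.measurePreserving_mk (2 * Real.pi) 0).quasiMeasurePreserving.ae hae_vol
  rw [zero_add] at hae_Ioc
  filter_upwards [hae_Ioc, ae_restrict_mem measurableSet_Ioc] with t ht ht_mem
  rw [← ht, AddCircle.liftIoc_coe_apply (by rwa [zero_add])]

end Symbol

section CoefficientOscillation

theorem tendsto_integral_mean_dist {Ω E : Type*} [MeasurableSpace Ω] {μ : Measure Ω}
    [IsFiniteMeasure μ] [NormedAddCommGroup E] {b : ℝ → Ω → E} {B : ℝ}
    (hb_meas : ∀ x ∈ Icc (0 : ℝ) 1, AEStronglyMeasurable (b x) μ)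
    (hb_le : ∀ x ∈ Icc (0 : ℝ) 1, ∀ᵐ ω ∂μ, ‖b x ω‖ ≤ B)
    (hb_osc : ∀ᵐ ω ∂μ, HasVanishingGridOscillation fun x => b x ω)
    {x y : ∀ m, Fin m → ℝ} (hx : ∀ m, IsGridTag (x m)) (hy : ∀ m, IsGridTag (y m)) :
    Tendsto (fun m : ℕ => ∫ ω, (m : ℝ)⁻¹ * ∑ i, dist (b (x m i) ω) (b (y m i) ω) ∂μ)
      atTop (𝓝 0) := by
  have hx01 (m) (i : Fin m) : x m i ∈ Icc (0 : ℝ) 1 := gridCell_subset_Icc i (hx m i)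
  have hy01 (m) (i : Fin m) : y m i ∈ Icc (0 : ℝ) 1 := gridCell_subset_Icc i (hy m i)
  rw [← integral_zero Ω ℝ (μ := μ)]
  refine tendsto_integral_of_dominated_convergence (fun _ => B + B) (fun m => ?_)
    (integrable_const _) (fun m => ?_) ?_
  · exact (Finset.aestronglyMeasurable_fun_sum _ fun i _ =>
      (hb_meas _ (hx01 m i)).dist (hb_meas _ (hy01 m i))).const_mul _
  · have hbx := ae_all_iff.2 fun i => hb_le _ (hx01 m i)
    have hby := ae_all_iff.2 fun i => hb_le _ (hy01 m i)
    filter_upwards [hbx, hby, hb_le 0 (by simp)] with ω hxω hyω hBω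
    have hB : 0 ≤ B := (norm_nonneg _).trans hBω
    rw [Real.norm_of_nonneg (by positivity), inv_mul_eq_div]
    refine div_le_of_le_mul₀ m.cast_nonneg (by positivity) ?_
    calc ∑ i, dist (b (x m i) ω) (b (y m i) ω) ≤ ∑ _i : Fin m, (B + B) := by
          gcongr with i
          exact (dist_le_norm_add_norm _ _).trans (add_le_add (hxω i) (hyω i))
      _ = (B + B) * m := by rw [Fin.sum_const, nsmul_eq_mul, mul_comm]
  · filter_upwards [hb_osc] with ω hω using hω x y hx hy

variable {a : ℝ → ℝ → ℂ}

theorem norm_exp_neg_I_mul (k : ℤ) (t : ℝ) : ‖Complex.exp (-(Complex.I * k * t))‖ = 1 := by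
  rw [Complex.norm_exp]
  simp

theorem norm_coeff_sub_le {x y : ℝ} (hx : IntegrableOn (a x) (Icc 0 (2 * Real.pi)))
    (hy : IntegrableOn (a y) (Icc 0 (2 * Real.pi))) (k : ℤ) :
    ‖coeff a k x - coeff a k y‖ ≤
      (2 * Real.pi)⁻¹ * ∫ t in Icc 0 (2 * Real.pi), ‖a x t - a y t‖ := by
  have hint {z : ℝ} (hz : IntegrableOn (a z) (Icc 0 (2 * Real.pi))) :
      IntegrableOn (fun t : ℝ => a z t * Complex.exp (-(Complex.I * k * t)))
        (Icc 0 (2 * Real.pi)) :=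
    hz.integrable.mul_bdd (c := 1) (by fun_prop) (ae_of_all _ fun t => (norm_exp_neg_I_mul k t).le)
  have hnorm : ‖(1 / (2 * Real.pi : ℂ))‖ = (2 * Real.pi)⁻¹ := by
    rw [one_div, norm_inv]
    norm_num [abs_of_pos Real.pi_pos]
  simp only [coeff, intervalIntegral.integral_of_le Real.two_pi_pos.le,
    ← integral_Icc_eq_integral_Ioc]
  rw [← mul_sub, ← integral_sub (hint hx) (hint hy), norm_mul, hnorm]
  gcongr
  refine (norm_integral_le_integral_norm _).trans_eq (integral_congr_ae (ae_of_all _ fun t => ?_))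
  simp only [← sub_mul, norm_mul, norm_exp_neg_I_mul, mul_one]

theorem hasVanishingGridOscillation_coeff {B : ℝ}
    (ha_meas : ∀ x ∈ Icc (0 : ℝ) 1,
      AEStronglyMeasurable (a x) (volume.restrict (Icc 0 (2 * Real.pi))))
    (ha_le : ∀ x ∈ Icc (0 : ℝ) 1, ∀ᵐ t ∂volume.restrict (Icc 0 (2 * Real.pi)), ‖a x t‖ ≤ B)
    (ha_osc : ∀ᵐ t ∂volume.restrict (Icc 0 (2 * Real.pi)),
      HasVanishingGridOscillation fun x => a x t) (k : ℤ) :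
    HasVanishingGridOscillation (coeff a k) := by
  intro x y hx hy
  have ha_int {z : ℝ} (hz : z ∈ Icc (0 : ℝ) 1) : IntegrableOn (a z) (Icc 0 (2 * Real.pi)) :=
    .of_bound measure_Icc_lt_top (ha_meas z hz) B (ha_le z hz)
  have hx_int (m) (i : Fin m) := ha_int (gridCell_subset_Icc i (hx m i))
  have hy_int (m) (i : Fin m) := ha_int (gridCell_subset_Icc i (hy m i))
  have hnorm_int (m) (i : Fin m) :
      IntegrableOn (fun t => ‖a (x m i) t - a (y m i) t‖) (Icc 0 (2 * Real.pi)) :=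
    ((hx_int m i).sub (hy_int m i)).norm
  have hlim := (tendsto_integral_mean_dist ha_meas ha_le ha_osc hx hy).const_mul (2 * Real.pi)⁻¹
  rw [mul_zero] at hlim
  refine squeeze_zero (fun m => by positivity) (fun m => ?_) hlim
  simp only [dist_eq_norm]
  rw [integral_const_mul, integral_finsetSum _ fun i _ => hnorm_int m i, mul_left_comm,
    Finset.mul_sum _ _ (2 * Real.pi)⁻¹]
  gcongr with i
  exact norm_coeff_sub_le (hx_int m i) (hy_int m i) k

end CoefficientOscillation

section CoefficientBounds

variable {a : ℝ → ℝ → ℂ} {x : ℝ}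

/-- The supremum norm `‖â_k‖_∞` as a real number; a junk value if it is infinite. -/
noncomputable def supCoeff (a : ℝ → ℝ → ℂ) (k : ℤ) : ℝ :=
  (⨆ x ∈ Icc (0 : ℝ) 1, ‖coeff a k x‖ₑ).toReal

theorem summable_supCoeff (hdecay : decayNorm a < ⊤) : Summable (supCoeff a) :=
  ENNReal.summable_toReal hdecay.ne

theorem norm_coeff_le_supCoeff (hdecay : decayNorm a < ⊤) (k : ℤ) (hx : x ∈ Icc (0 : ℝ) 1) :
    ‖coeff a k x‖ ≤ supCoeff a k := by
  rw [← toReal_enorm]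
  exact ENNReal.toReal_mono (ENNReal.ne_top_of_tsum_ne_top hdecay.ne k)
    (le_iSup₂ (f := fun x (_ : x ∈ Icc (0 : ℝ) 1) => ‖coeff a k x‖ₑ) x hx)

theorem summable_norm_coeff (hdecay : decayNorm a < ⊤) (hx : x ∈ Icc (0 : ℝ) 1) :
    Summable fun k => ‖coeff a k x‖ :=
  (summable_supCoeff hdecay).of_nonneg_of_le (fun _ => norm_nonneg _)
    fun k => norm_coeff_le_supCoeff hdecay k hx

theorem norm_symbol_apply_le (hdecay : decayNorm a < ⊤) (hx : x ∈ Icc (0 : ℝ) 1)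
    (θ : AddCircle (2 * Real.pi)) : ‖symbol a x θ‖ ≤ ∑' k, supCoeff a k := by
  have hc := summable_norm_coeff hdecay hx
  calc ‖symbol a x θ‖ ≤ ‖symbol a x‖ := (symbol a x).norm_coe_le_norm θ
    _ ≤ ∑' k, ‖coeff a k x‖ := norm_circleSeries_le hc
    _ ≤ ∑' k, supCoeff a k :=
      hc.tsum_le_tsum (fun k => norm_coeff_le_supCoeff hdecay k hx) (summable_supCoeff hdecay)

theorem ae_continuousAt_coeff
    (ha_x : ∀ t ∈ Icc 0 (2 * Real.pi), RiemannIntegrable fun x => a x t)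
    (ha_t : ∀ x ∈ Icc (0 : ℝ) 1, MemLp (a x) 2 (volume.restrict (Icc 0 (2 * Real.pi))))
    (hdecay : decayNorm a < ⊤) :
    ∀ᵐ x ∂volume.restrict (Ioo (0 : ℝ) 1), ∀ k, ContinuousAt (coeff a k) x := by
  refine ae_all_iff.2 fun k => (hasVanishingGridOscillation_coeff (B := ∑' k, supCoeff a k)
    (fun x hx => (ha_t x hx).aestronglyMeasurable) (fun x hx => ?_) ?_ k).ae_continuousAt
  · filter_upwards [ae_eq_symbol (ha_t x hx) (summable_norm_coeff hdecay hx)] with t ht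
    rw [ht]
    exact norm_symbol_apply_le hdecay hx _
  · filter_upwards [ae_restrict_mem measurableSet_Icc] with t ht
    exact (ha_x t ht).hasVanishingGridOscillation

end CoefficientBounds

section ZeroExtension

variable {N : ℕ}

/-- The matrix indexed by `ℤ` which has `S` as its block of rows and columns `0, …, N - 1` and is
zero elsewhere, so that shifts of indices need no side conditions. -/
def extendZero (S : Matrix (Fin N) (Fin N) ℂ) (i j : ℤ) : ℂ :=
  if h : (0 ≤ i ∧ i < N) ∧ (0 ≤ j ∧ j < N) then
    S ⟨i.toNat, by lia⟩ ⟨j.toNat, by lia⟩ else 0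

theorem extendZero_natCast (S : Matrix (Fin N) (Fin N) ℂ) (i j : Fin N) :
    extendZero S (i : ℕ) (j : ℕ) = S i j := by
  rw [extendZero, dif_pos (by simp)]
  rfl

theorem extendZero_eq_zero_of_left (S : Matrix (Fin N) (Fin N) ℂ) {i : ℤ} (j : ℤ)
    (hi : ¬(0 ≤ i ∧ i < N)) : extendZero S i j = 0 :=
  dif_neg fun h => hi h.1

theorem extendZero_eq_zero_of_right (S : Matrix (Fin N) (Fin N) ℂ) (i : ℤ) {j : ℤ}
    (hj : ¬(0 ≤ j ∧ j < N)) : extendZero S i j = 0 :=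
  dif_neg fun h => hj h.2

theorem exists_fin_natCast_eq {i : ℤ} (hi : 0 ≤ i ∧ i < N) : ∃ k : Fin N, ((k : ℕ) : ℤ) = i :=
  ⟨⟨i.toNat, by lia⟩, Int.toNat_of_nonneg hi.1⟩

theorem tsum_int_eq_sum_fin {E : Type*} [AddCommMonoid E] [TopologicalSpace E] {g : ℤ → E}
    (hg : ∀ l : ℤ, ¬(0 ≤ l ∧ l < N) → g l = 0) : ∑' l, g l = ∑ j : Fin N, g (j : ℕ) := by
  have hinj : Function.Injective fun j : Fin N => ((j : ℕ) : ℤ) := fun i j h => by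
    simpa [Fin.ext_iff] using h
  rw [← tsum_fintype (L := .unconditional _)]
  refine (hinj.tsum_eq fun l hl => ?_).symm
  exact exists_fin_natCast_eq (not_not.1 (mt (hg l) hl))

theorem extendZero_mul (S T : Matrix (Fin N) (Fin N) ℂ) (i j : ℤ) :
    extendZero (S * T) i j = ∑' l, extendZero S i l * extendZero T l j := by
  rw [tsum_int_eq_sum_fin fun l hl => by rw [extendZero_eq_zero_of_right S i hl, zero_mul]]
  by_cases hi : 0 ≤ i ∧ i < N
  · by_cases hj : 0 ≤ j ∧ j < N
    · obtain ⟨i, rfl⟩ := exists_fin_natCast_eq hi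
      obtain ⟨j, rfl⟩ := exists_fin_natCast_eq hj
      simp only [extendZero_natCast, Matrix.mul_apply]
    · simp [extendZero_eq_zero_of_right _ _ hj]
  · simp [extendZero_eq_zero_of_left _ _ hi]

theorem extendZero_add (S T : Matrix (Fin N) (Fin N) ℂ) (i j : ℤ) :
    extendZero (S + T) i j = extendZero S i j + extendZero T i j := by
  unfold extendZero
  split_ifs
  · rfl
  · rw [add_zero]

theorem extendZero_algebraMap (z : ℂ) (i j : ℤ) :
    extendZero (algebraMap ℂ (Matrix (Fin N) (Fin N) ℂ) z) i j =
      if (0 ≤ i ∧ i < N) ∧ i = j then z else 0 := by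
  by_cases hi : 0 ≤ i ∧ i < N
  · by_cases hj : 0 ≤ j ∧ j < N
    · obtain ⟨i, rfl⟩ := exists_fin_natCast_eq hi
      obtain ⟨j, rfl⟩ := exists_fin_natCast_eq hj
      simp [extendZero_natCast, Matrix.algebraMap_matrix_apply, hi, Fin.ext_iff]
    · rw [extendZero_eq_zero_of_right _ _ hj, if_neg (by lia)]
  · rw [extendZero_eq_zero_of_left _ _ hi, if_neg (by lia)]

theorem sum_norm_sq_row_eq_tsum (S : Matrix (Fin N) (Fin N) ℂ) (i : Fin N) :
    ∑ j, ‖S i j‖ ^ 2 = ∑' k : ℤ, ‖extendZero S (i : ℕ) ((i : ℕ) + k)‖ ^ 2 := by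
  have hshift := (Equiv.addLeft ((i : ℕ) : ℤ)).tsum_eq fun j => ‖extendZero S (i : ℕ) j‖ ^ 2
  simp only [Equiv.coe_addLeft] at hshift
  rw [hshift, tsum_int_eq_sum_fin (N := N) fun l hl => by simp [extendZero_eq_zero_of_right S _ hl]]
  simp only [extendZero_natCast]

end ZeroExtension

section DiagonalBounds

variable {N : ℕ} {g h : ℤ → ℝ}

/-- The entries of `S` on the `k`-th diagonal are bounded by `h k`. -/
def DiagBounded (h : ℤ → ℝ) (S : Matrix (Fin N) (Fin N) ℂ) : Prop :=
  ∀ i j : ℤ, ‖extendZero S i j‖ ≤ h (j - i)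

theorem summable_mul_sub (hg : Summable g) (hh : Summable h) :
    Summable fun q : ℤ × ℤ => g q.2 * h (q.1 - q.2) := by
  let shear : ℤ × ℤ ≃ ℤ × ℤ := (Equiv.prodComm ℤ ℤ).trans
    (Equiv.prodShear (Equiv.refl ℤ) Equiv.subRight)
  have hsummable := (shear.summable_iff).2 (summable_mul_of_summable_norm hg.norm hh.norm)
  exact hsummable

theorem summable_sq (hg : Summable g) : Summable fun k => g k ^ 2 := by
  simp only [sq]
  exact (summable_mul_of_summable_norm hg.norm hg.norm).comp_injective (i := fun k => (k, k))
    fun _ _ h => (Prod.mk.inj h).1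

theorem DiagBounded.mul {S T : Matrix (Fin N) (Fin N) ℂ} (hS : DiagBounded g S)
    (hT : DiagBounded h T) (hg : Summable g) (hh : Summable h) :
    DiagBounded (fun k => ∑' l, g l * h (k - l)) (S * T) := by
  intro i j
  have hsummable : Summable fun l => g l * h (j - i - l) :=
    (summable_mul_sub hg hh).prod_factor (j - i)
  rw [extendZero_mul, ← (Equiv.addLeft i).tsum_eq]
  refine tsum_of_norm_bounded hsummable.hasSum fun l => ?_
  rw [norm_mul, Equiv.coe_addLeft]
  refine mul_le_mul (by simpa using hS i (i + l)) ?_ (norm_nonneg _) ?_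
  · simpa only [sub_sub] using hT (i + l) j
  · exact (norm_nonneg _).trans (by simpa using hS i (i + l))

theorem exists_summable_diagBounded_aeval {ι : Type*} {N : ι → ℕ}
    {T : ∀ n, Matrix (Fin (N n)) (Fin (N n)) ℂ} (hT : ∀ n, DiagBounded h (T n)) (hh : Summable h)
    (p : Polynomial ℂ) :
    ∃ g : ℤ → ℝ, Summable g ∧ ∀ n, DiagBounded g (Polynomial.aeval (T n) p) := by
  induction p using Polynomial.induction_on with
  | C z =>
    refine ⟨Pi.single 0 ‖z‖, (hasSum_pi_single 0 ‖z‖).summable, fun n i j => ?_⟩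
    rw [Polynomial.aeval_C, extendZero_algebraMap]
    by_cases hij : i = j
    · rw [hij, sub_self, Pi.single_eq_same]
      split_ifs <;> simp
    · rw [if_neg fun h => hij h.2, Pi.single_eq_of_ne (sub_ne_zero.2 (Ne.symm hij)), norm_zero]
  | add p q hp hq =>
    obtain ⟨g₁, hg₁, hp⟩ := hp
    obtain ⟨g₂, hg₂, hq⟩ := hq
    refine ⟨g₁ + g₂, hg₁.add hg₂, fun n i j => ?_⟩
    rw [map_add, extendZero_add]
    exact norm_add_le_of_le (hp n i j) (hq n i j)
  | monomial m z ih =>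
    obtain ⟨g, hg, hm⟩ := ih
    refine ⟨_, (summable_mul_sub hg hh).prod, fun n => ?_⟩
    rw [pow_succ, ← mul_assoc, map_mul, Polynomial.aeval_X]
    exact (hm n).mul (hT n) hg hh

end DiagonalBounds

section DiagonalLimits

open AddCircle

variable {N : ℕ → ℕ} {S T : ∀ n, Matrix (Fin (N n)) (Fin (N n)) ℂ} {r : ℕ → ℤ} {b c : ℤ → ℂ}
  {g h : ℤ → ℝ}

/-- Seen from the row `r n`, the matrix `T n` converges entrywise to the Laurent matrix
`(c (j - i))`. -/
def TendstoLaurent (T : ∀ n, Matrix (Fin (N n)) (Fin (N n)) ℂ) (r : ℕ → ℤ) (c : ℤ → ℂ) : Prop :=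
  ∀ u v : ℤ, Tendsto (fun n => extendZero (T n) (r n + u) (r n + v)) atTop (𝓝 (c (v - u)))

theorem TendstoLaurent.mul (hS : TendstoLaurent S r b) (hT : TendstoLaurent T r c)
    (hS_le : ∀ n, DiagBounded g (S n)) (hT_le : ∀ n, DiagBounded h (T n)) (hg : Summable g)
    (hh : Summable h) :
    TendstoLaurent (fun n => S n * T n) r fun k => ∑' l, b l * c (k - l) := by
  intro u v
  have hsummable : Summable fun l => g l * h (v - u - l) :=
    (summable_mul_sub hg hh).prod_factor (v - u)
  have hshift (n : ℕ) : extendZero (S n * T n) (r n + u) (r n + v) =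
      ∑' l, extendZero (S n) (r n + u) (r n + (u + l)) *
        extendZero (T n) (r n + (u + l)) (r n + v) := by
    rw [extendZero_mul, ← (Equiv.addLeft (r n + u)).tsum_eq]
    simp only [Equiv.coe_addLeft, add_assoc]
  simp only [hshift]
  refine tendsto_tsum_of_dominated_convergence hsummable (fun l => ?_) (.of_forall fun n l => ?_)
  · simpa only [add_sub_cancel_left, sub_sub] using (hS u (u + l)).mul (hT (u + l) v)
  · have hS_entry := hS_le n (r n + u) (r n + (u + l))
    have hT_entry := hT_le n (r n + (u + l)) (r n + v)
    rw [add_sub_add_left_eq_sub] at hS_entry hT_entry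
    rw [add_sub_cancel_left] at hS_entry
    rw [← sub_sub] at hT_entry
    rw [norm_mul]
    exact mul_le_mul hS_entry hT_entry (norm_nonneg _) ((norm_nonneg _).trans hS_entry)

variable {P : ℝ} [Fact (0 < P)]

theorem fourierCoeff_algebraMap (z : ℂ) (k : ℤ) :
    fourierCoeff (algebraMap ℂ C(AddCircle P, ℂ) z) k = if k = 0 then z else 0 := by
  have hconst : algebraMap ℂ C(AddCircle P, ℂ) z = z • fourier 0 := by
    ext θ
    simp
  rw [hconst, ContinuousMap.coe_smul, fourierCoeff.const_smul, fourierCoeff_fourier,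
    Pi.single_apply, smul_eq_mul, mul_ite, mul_one, mul_zero]

theorem TendstoLaurent.aeval (hT : TendstoLaurent T r c) (hT_le : ∀ n, DiagBounded h (T n))
    (hh : Summable h) (hc : Summable fun k => ‖c k‖)
    (hr : ∀ u : ℤ, ∀ᶠ n in atTop, 0 ≤ r n + u ∧ r n + u < N n) (p : Polynomial ℂ) :
    TendstoLaurent (fun n => Polynomial.aeval (T n) p) r
      (fourierCoeff (Polynomial.aeval (circleSeries c : C(AddCircle P, ℂ)) p)) := by
  induction p using Polynomial.induction_on with
  | C z =>
    intro u v
    simp only [Polynomial.aeval_C, extendZero_algebraMap, fourierCoeff_algebraMap]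
    refine tendsto_const_nhds.congr' ?_
    filter_upwards [hr u] with n hn
    simp only [hn, true_and, add_right_inj, sub_eq_zero, eq_comm]
  | add p q hp hq =>
    intro u v
    have hint (f : C(AddCircle P, ℂ)) : Integrable f haarAddCircle :=
      f.continuous.integrable_of_hasCompactSupport (.of_compactSpace f)
    simp only [map_add, extendZero_add]
    rw [ContinuousMap.coe_add, fourierCoeff.add (hint _) (hint _)]
    exact (hp u v).add (hq u v)
  | monomial m z ih =>
    obtain ⟨g, hg, hm⟩ :=
      exists_summable_diagBounded_aeval hT_le hh (Polynomial.C z * Polynomial.X ^ m)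
    have hmul := ih.mul hT hm hT_le hg hh
    rw [funext fun k => (hasSum_fourierCoeff_mul_circleSeries _ hc k).tsum_eq] at hmul
    simpa only [pow_succ, ← mul_assoc, map_mul, Polynomial.aeval_X] using hmul

theorem TendstoLaurent.tendsto_sum_norm_sq_row {i : ∀ n, Fin (N n)} {f : C(AddCircle P, ℂ)}
    (hS : TendstoLaurent S (fun n => (i n : ℕ)) (fourierCoeff f))
    (hS_le : ∀ n, DiagBounded g (S n)) (hg : Summable fun k => g k ^ 2) :
    Tendsto (fun n => ∑ j, ‖S n (i n) j‖ ^ 2) atTop (𝓝 (∫ θ, ‖f θ‖ ^ 2 ∂haarAddCircle)) := by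
  rw [← (hasSum_norm_sq_fourierCoeff f).tsum_eq]
  simp only [sum_norm_sq_row_eq_tsum]
  refine tendsto_tsum_of_dominated_convergence hg (fun k => ?_) (.of_forall fun n k => ?_)
  · simpa only [add_zero, sub_zero] using ((hS 0 k).norm).pow 2
  · rw [norm_pow, norm_norm]
    gcongr
    simpa only [add_sub_cancel_left] using hS_le n (i n : ℕ) ((i n : ℕ) + k)

theorem DiagBounded.sum_norm_sq_row_le {N : ℕ} {S : Matrix (Fin N) (Fin N) ℂ}
    (hS : DiagBounded g S) (hg : Summable fun k => g k ^ 2) (i : Fin N) :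
    ∑ j, ‖S i j‖ ^ 2 ≤ ∑' k, g k ^ 2 := by
  rw [sum_norm_sq_row_eq_tsum]
  have hle (k : ℤ) : ‖extendZero S (i : ℕ) ((i : ℕ) + k)‖ ^ 2 ≤ g k ^ 2 := by
    gcongr
    simpa only [add_sub_cancel_left] using hS (i : ℕ) ((i : ℕ) + k)
  exact (hg.of_nonneg_of_le (fun _ => by positivity) hle).tsum_le_tsum hle hg

end DiagonalLimits

section GridMeans

/-- The index `i` of the cell `[i / N, (i + 1) / N)` containing `x`; a junk value unless
`x ∈ [0, 1)`. -/
noncomputable def gridIndex (N : ℕ) [NeZero N] (x : ℝ) : Fin N :=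
  Fin.ofNat N ⌊x * N⌋₊

variable {N : ℕ} [NeZero N]

theorem val_gridIndex {x : ℝ} (hx : x ∈ Ico (0 : ℝ) 1) :
    (gridIndex N x : ℕ) = ⌊x * N⌋₊ := by
  have hN : (0 : ℝ) < N := by exact_mod_cast NeZero.pos N
  refine Nat.mod_eq_of_lt ((Nat.floor_lt (mul_nonneg hx.1 hN.le)).2 ?_)
  exact mul_lt_of_lt_one_left hN hx.2

theorem measurable_gridIndex : Measurable (gridIndex N) :=
  (measurable_from_nat (f := Fin.ofNat N)).comp (Nat.measurable_floor.comp (by fun_prop))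

theorem preimage_gridIndex_inter_Ico (i : Fin N) :
    gridIndex N ⁻¹' {i} ∩ Ico 0 1 = Ico ((i : ℝ) / N) (((i : ℝ) + 1) / N) := by
  have hN : (0 : ℝ) < N := by exact_mod_cast NeZero.pos N
  ext x
  rw [mem_Ico, div_le_iff₀ hN, lt_div_iff₀ hN]
  constructor
  · rintro ⟨rfl, hx⟩
    rw [val_gridIndex hx]
    exact ⟨Nat.floor_le (mul_nonneg hx.1 hN.le), Nat.lt_floor_add_one _⟩
  · rintro ⟨hix, hxi⟩
    have hxN : 0 ≤ x * N := i.val.cast_nonneg.trans hix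
    have hiN : (i : ℝ) + 1 ≤ N := by exact_mod_cast i.isLt
    have hx : x ∈ Ico (0 : ℝ) 1 :=
      ⟨nonneg_of_mul_nonneg_left hxN hN, (mul_lt_iff_lt_one_left hN).1 (hxi.trans_le hiN)⟩
    refine ⟨Fin.ext ?_, hx⟩
    rw [val_gridIndex hx]
    exact (Nat.floor_eq_iff hxN).2 ⟨hix, hxi⟩

theorem setIntegral_comp_gridIndex (g : Fin N → ℝ) :
    ∫ x in Ico 0 1, g (gridIndex N x) = (N : ℝ)⁻¹ * ∑ i, g i := by
  have hmeas := measurable_gridIndex (N := N)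
  rw [← integral_map hmeas.aemeasurable (measurable_of_finite g).aestronglyMeasurable,
    integral_fintype .of_finite, Finset.mul_sum]
  refine Finset.sum_congr rfl fun i _ => ?_
  rw [map_measureReal_apply hmeas (measurableSet_singleton i),
    measureReal_restrict_apply (hmeas (measurableSet_singleton i)), preimage_gridIndex_inter_Ico,
    Real.volume_real_Ico_of_le (by gcongr; linarith), ← sub_div, add_sub_cancel_left, one_div,
    smul_eq_mul]

theorem tendsto_mean_of_tendsto_gridIndex {g : ∀ n : ℕ, Fin (n + 1) → ℝ} {G : ℝ → ℝ} {C : ℝ}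
    (hg : ∀ n i, ‖g n i‖ ≤ C)
    (hlim : ∀ᵐ x ∂volume.restrict (Ioo (0 : ℝ) 1),
      Tendsto (fun n => g n (gridIndex (n + 1) x)) atTop (𝓝 (G x))) :
    Tendsto (fun n : ℕ => ((n : ℝ) + 1)⁻¹ * ∑ i, g n i) atTop (𝓝 (∫ x in Ioo 0 1, G x)) := by
  rw [Measure.restrict_congr_set Ioo_ae_eq_Ico] at hlim ⊢
  have hmean := tendsto_integral_of_dominated_convergence (fun _ => C)
    (fun n => ((measurable_of_finite (g n)).comp measurable_gridIndex).aestronglyMeasurable)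
    (integrable_const _) (fun n => ae_of_all _ fun x => hg n _) hlim
  simpa only [Function.comp_apply, setIntegral_comp_gridIndex, Nat.cast_add, Nat.cast_one]
    using hmean

theorem tendsto_gridIndex_add_div {x : ℝ} (hx : x ∈ Ico (0 : ℝ) 1) (u : ℤ) :
    Tendsto (fun n : ℕ => ((gridIndex (n + 1) x : ℝ) + u) / ((n : ℝ) + 1)) atTop (𝓝 x) := by
  have hn : Tendsto (fun n : ℕ => (n : ℝ) + 1) atTop atTop :=
    tendsto_natCast_atTop_atTop.atTop_add tendsto_const_nhds
  have hfloor := ((tendsto_nat_floor_mul_div_atTop hx.1).comp hn).add (hn.const_div_atTop (u : ℝ))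
  rw [add_zero] at hfloor
  refine hfloor.congr fun n => ?_
  rw [val_gridIndex hx, add_div, Nat.cast_add_one]
  rfl

end GridMeans

section SymbolMatrices

variable {a : ℝ → ℝ → ℂ} {x : ℝ}

theorem extendZero_matrix {n : ℕ} {i j : ℤ} (hi : 0 ≤ i ∧ i < n + 1) (hj : 0 ≤ j ∧ j < n + 1) :
    extendZero (matrix a n) i j = coeff a (j - i) (((i : ℝ) + j) / (2 * n + 2)) := by
  obtain ⟨i, rfl⟩ := exists_fin_natCast_eq (N := n + 1) (mod_cast hi)
  obtain ⟨j, rfl⟩ := exists_fin_natCast_eq (N := n + 1) (mod_cast hj)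
  rw [extendZero_natCast, matrix, Matrix.of_apply, Int.cast_natCast, Int.cast_natCast]

theorem diagBounded_matrix (hdecay : decayNorm a < ⊤) (n : ℕ) :
    DiagBounded (supCoeff a) (matrix a n) := by
  intro i j
  by_cases hi : 0 ≤ i ∧ i < (n + 1 : ℕ)
  · by_cases hj : 0 ≤ j ∧ j < (n + 1 : ℕ)
    · obtain ⟨i, rfl⟩ := exists_fin_natCast_eq hi
      obtain ⟨j, rfl⟩ := exists_fin_natCast_eq hj
      rw [extendZero_natCast]
      refine norm_coeff_le_supCoeff hdecay _ ⟨by positivity, (div_le_one (by positivity)).2 ?_⟩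
      have hin : (i : ℝ) ≤ n := by exact_mod_cast i.is_le
      have hjn : (j : ℝ) ≤ n := by exact_mod_cast j.is_le
      linarith
    · rw [extendZero_eq_zero_of_right _ _ hj, norm_zero]
      exact ENNReal.toReal_nonneg
  · rw [extendZero_eq_zero_of_left _ _ hi, norm_zero]
    exact ENNReal.toReal_nonneg

theorem eventually_gridIndex_add_mem (hx : x ∈ Ioo (0 : ℝ) 1) (u : ℤ) :
    ∀ᶠ n : ℕ in atTop, 0 ≤ ((gridIndex (n + 1) x : ℕ) : ℤ) + u ∧
      ((gridIndex (n + 1) x : ℕ) : ℤ) + u < (n + 1 : ℕ) := by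
  filter_upwards [(tendsto_gridIndex_add_div (Ioo_subset_Ico_self hx) u).eventually
    (Ioo_mem_nhds hx.1 hx.2)] with n hn
  have hn1 : (0 : ℝ) < (n : ℝ) + 1 := by positivity
  have hpos := (div_pos_iff_of_pos_right hn1).1 hn.1
  have hlt := (div_lt_one hn1).1 hn.2
  exact ⟨by exact_mod_cast hpos.le, by exact_mod_cast hlt⟩

theorem tendstoLaurent_matrix (hx : x ∈ Ioo (0 : ℝ) 1) (hcont : ∀ k, ContinuousAt (coeff a k) x) :
    TendstoLaurent (matrix a) (fun n => (gridIndex (n + 1) x : ℕ)) fun k => coeff a k x := by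
  intro u v
  have hx_Ico := Ioo_subset_Ico_self hx
  have hmid := ((tendsto_gridIndex_add_div hx_Ico u).add
    (tendsto_gridIndex_add_div hx_Ico v)).div_const 2
  rw [add_self_div_two] at hmid
  refine ((hcont (v - u)).tendsto.comp hmid).congr' ?_
  filter_upwards [eventually_gridIndex_add_mem hx u, eventually_gridIndex_add_mem hx v]
    with n hu hv
  rw [extendZero_matrix (mod_cast hu) (mod_cast hv), Function.comp_apply, add_sub_add_left_eq_sub]
  congr 1
  push_cast
  field_simp

theorem tendsto_mean_norm_sq_aeval_matrix
    (hcont : ∀ᵐ x ∂volume.restrict (Ioo (0 : ℝ) 1), ∀ k, ContinuousAt (coeff a k) x)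
    (hdecay : decayNorm a < ⊤) (p : Polynomial ℂ) :
    Tendsto (fun n : ℕ => ((n : ℝ) + 1)⁻¹ * ∑ i, ∑ j, ‖Polynomial.aeval (matrix a n) p i j‖ ^ 2)
      atTop (𝓝 (∫ x in Ioo 0 1, ∫ θ, ‖p.eval (symbol a x θ)‖ ^ 2 ∂AddCircle.haarAddCircle)) := by
  obtain ⟨g, hg, hg_le⟩ :=
    exists_summable_diagBounded_aeval (diagBounded_matrix hdecay) (summable_supCoeff hdecay) p
  have hg_sq := summable_sq hg
  refine tendsto_mean_of_tendsto_gridIndex (C := ∑' k, g k ^ 2) (fun n i => ?_) ?_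
  · rw [Real.norm_of_nonneg (by positivity)]
    exact (hg_le n).sum_norm_sq_row_le hg_sq i
  · filter_upwards [hcont, ae_restrict_mem measurableSet_Ioo] with x hx_cont hx
    have hrow := ((tendstoLaurent_matrix hx hx_cont).aeval (P := 2 * Real.pi)
      (diagBounded_matrix hdecay) (summable_supCoeff hdecay)
      (summable_norm_coeff hdecay (Ioo_subset_Icc_self hx)) (eventually_gridIndex_add_mem hx)
      p).tendsto_sum_norm_sq_row hg_le hg_sq
    simpa only [symbol, Polynomial.aeval_continuousMap_apply, Polynomial.coe_aeval_eq_eval]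
      using hrow

end SymbolMatrices

section EssentialRange

variable {a : ℝ → ℝ → ℂ} {z : ℂ}

theorem notMem_essRange_iff : z ∉ essRange a ↔ ∃ r > 0,
    ∀ᵐ q ∂volume.restrict (Icc (0 : ℝ) 1 ×ˢ Icc 0 (2 * Real.pi)), a q.1 q.2 ∉ Metric.ball z r := by
  simp only [ae_restrict_iff' (measurableSet_Icc.prod measurableSet_Icc), ae_iff, essRange,
    mem_ofPred_eq, not_forall, not_lt, nonpos_iff_eq_zero, not_not, exists_prop, gt_iff_lt]

theorem isClosed_essRange : IsClosed (essRange a) := by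
  rw [← isOpen_compl_iff, Metric.isOpen_iff]
  intro z hz
  obtain ⟨r, hr, hz_ball⟩ := notMem_essRange_iff.1 hz
  refine ⟨r / 2, half_pos hr, fun w hw => notMem_essRange_iff.2 ⟨r / 2, half_pos hr, ?_⟩⟩
  have hsub : Metric.ball w (r / 2) ⊆ Metric.ball z r :=
    Metric.ball_subset_ball' (by linarith [Metric.mem_ball.1 hw])
  filter_upwards [hz_ball] with q hq using fun hqw => hq (hsub hqw)

theorem ae_mem_essRange :
    ∀ᵐ q ∂volume.restrict (Icc (0 : ℝ) 1 ×ˢ Icc 0 (2 * Real.pi)), a q.1 q.2 ∈ essRange a := by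
  choose! r hr hr_ball using fun z (hz : z ∈ (essRange a)ᶜ) => notMem_essRange_iff.1 hz
  obtain ⟨s, hs, hs_countable, hs_cover⟩ := TopologicalSpace.countable_cover_nhdsWithin
    fun z hz => mem_nhdsWithin_of_mem_nhds (Metric.ball_mem_nhds z (hr z hz))
  filter_upwards [(ae_ball_iff hs_countable).2 fun z hz => hr_ball z (hs hz)] with q hq
  by_contra hq_mem
  obtain ⟨z, hz, hqz⟩ := mem_iUnion₂.1 (hs_cover hq_mem)
  exact hq z hz hqz

theorem forall_mem_of_ae_coe_mem {X : Type*} [TopologicalSpace X]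
    {f : AddCircle (2 * Real.pi) → X} (hf : Continuous f) {F : Set X} (hF : IsClosed F)
    (h : ∀ᵐ t : ℝ ∂volume.restrict (Icc 0 (2 * Real.pi)), f t ∈ F)
    (θ : AddCircle (2 * Real.pi)) : f θ ∈ F := by
  have hopen : IsOpen (f ⁻¹' Fᶜ) := hF.isOpen_compl.preimage hf
  have hmk := AddCircle.measurePreserving_mk (2 * Real.pi) 0
  rw [zero_add, restrict_Ioc_eq_restrict_Icc] at hmk
  have hnull : volume (f ⁻¹' Fᶜ) = 0 := by
    rw [← hmk.measure_preimage hopen.measurableSet.nullMeasurableSet]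
    exact ae_iff.1 h
  by_contra hθ
  exact (hopen.eq_empty_of_measure_zero hnull).subset hθ

theorem ae_forall_symbol_mem_essRange
    (ha_t : ∀ x ∈ Icc (0 : ℝ) 1, MemLp (a x) 2 (volume.restrict (Icc 0 (2 * Real.pi))))
    (hdecay : decayNorm a < ⊤) :
    ∀ᵐ x ∂volume.restrict (Ioo (0 : ℝ) 1), ∀ θ, symbol a x θ ∈ essRange a := by
  have hae := ae_mem_essRange (a := a)
  rw [Measure.volume_eq_prod, ← Measure.prod_restrict] at hae
  rw [restrict_Ioo_eq_restrict_Icc]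
  filter_upwards [Measure.ae_ae_of_ae_prod hae, ae_restrict_mem measurableSet_Icc] with x hx hx_mem
  refine forall_mem_of_ae_coe_mem (symbol a x).continuous isClosed_essRange ?_
  filter_upwards [hx, ae_eq_symbol (ha_t x hx_mem) (summable_norm_coeff hdecay hx_mem)]
    with t ht ht_eq
  rwa [← ht_eq]

end EssentialRange

section EigenvalueCount

variable {a : ℝ → ℝ → ℂ} {U W : Set ℂ}

theorem eigCount_le_of_subset_union {U₁ U₂ : Set ℂ} (h : U ⊆ U₁ ∪ U₂) (n : ℕ) :
    eigCount a U n ≤ eigCount a U₁ n + eigCount a U₂ n := by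
  classical
  simp only [eigCount, Multiset.countP_eq_card_filter]
  rw [← Multiset.card_add, Multiset.filter_add_filter, Multiset.card_add]
  exact le_add_right (Multiset.card_le_card (Multiset.monotone_filter_right _ fun z hz => h hz))

theorem eigCount_add_eigCount_compl (V : Set ℂ) (n : ℕ) :
    eigCount a V n + eigCount a Vᶜ n = n + 1 := by
  classical
  have hcard : (matrix a n).charpoly.roots.card = n + 1 := by
    rw [Polynomial.splits_iff_card_roots.1 (IsAlgClosed.splits _),
      Matrix.charpoly_natDegree_eq_dim, Fintype.card_fin]
  rw [← hcard, Multiset.card_eq_countP_add_countP (fun z => z ∈ V)]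
  unfold eigCount
  congr!

/-- All but `o(n)` of the eigenvalues of `T_n(a)` lie outside `U`. -/
def IsNegligible (a : ℝ → ℝ → ℂ) (U : Set ℂ) : Prop :=
  (fun n : ℕ => (eigCount a U n : ℝ)) =o[atTop] fun n : ℕ => (n : ℝ) + 1

namespace IsNegligible

theorem of_subset_union {U₁ U₂ : Set ℂ} (h₁ : IsNegligible a U₁) (h₂ : IsNegligible a U₂)
    (h : U ⊆ U₁ ∪ U₂) : IsNegligible a U := by
  refine IsBigO.trans_isLittleO (.of_norm_le fun n => ?_) (IsLittleO.add h₁ h₂)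
  rw [Real.norm_natCast]
  exact_mod_cast eigCount_le_of_subset_union h n

theorem mono (hW : IsNegligible a W) (h : U ⊆ W) : IsNegligible a U :=
  hW.of_subset_union hW (h.trans subset_union_left)

theorem union (hU : IsNegligible a U) (hW : IsNegligible a W) : IsNegligible a (U ∪ W) :=
  hU.of_subset_union hW subset_rfl

theorem tendsto_eigCount_compl_div (hU : IsNegligible a U) :
    Tendsto (fun n : ℕ => (eigCount a Uᶜ n : ℝ) / ((n : ℝ) + 1)) atTop (𝓝 1) := by
  have hlim := hU.tendsto_div_nhds_zero.const_sub 1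
  rw [sub_zero] at hlim
  refine hlim.congr fun n => ?_
  have hn : (n : ℝ) + 1 ≠ 0 := by positivity
  have hadd : (eigCount a U n : ℝ) + eigCount a Uᶜ n = n + 1 := by
    exact_mod_cast eigCount_add_eigCount_compl U n
  field_simp
  linarith

theorem isLittleO_natCast (hU : IsNegligible a U) :
    (fun n : ℕ => (eigCount a U n : ℝ)) =o[atTop] fun n : ℕ => (n : ℝ) := by
  refine hU.trans_isBigO ((isBigO_refl _ _).add ?_)
  exact (isLittleO_const_left.2 (.inr (tendsto_norm_atTop_atTop.comp
    tendsto_natCast_atTop_atTop))).isBigO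

end IsNegligible

theorem integral_integral_norm_sq_le {p : Polynomial ℂ} {δ : ℝ}
    (hp : ∀ᵐ x ∂volume.restrict (Ioo (0 : ℝ) 1), ∀ θ, ‖p.eval (symbol a x θ)‖ ≤ δ) :
    ∫ x in Ioo (0 : ℝ) 1, ∫ θ, ‖p.eval (symbol a x θ)‖ ^ 2 ∂AddCircle.haarAddCircle ≤ δ ^ 2 := by
  have hinner : ∀ᵐ x ∂volume.restrict (Ioo (0 : ℝ) 1),
      ‖∫ θ, ‖p.eval (symbol a x θ)‖ ^ 2 ∂AddCircle.haarAddCircle‖ ≤ δ ^ 2 := by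
    filter_upwards [hp] with x hx
    have hsq (θ) : ‖‖p.eval (symbol a x θ)‖ ^ 2‖ ≤ δ ^ 2 := by
      rw [norm_pow, norm_norm]
      gcongr
      exact hx θ
    simpa only [probReal_univ, mul_one] using norm_integral_le_of_norm_le_const
      (μ := AddCircle.haarAddCircle) (ae_of_all _ hsq)
  have houter := norm_integral_le_of_norm_le_const hinner
  rw [measureReal_restrict_apply_univ, Real.volume_real_Ioo_of_le zero_le_one, sub_zero,
    mul_one] at houter
  exact (le_abs_self _).trans houter

/-- Schur's inequality for the powers `p ^ m`: the limiting mean square `∫∫ ‖p ^ m ∘ a‖ ^ 2` decays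
geometrically in `m`, whereas every eigenvalue in `U` contributes at least `1`. -/
theorem isNegligible_of_norm_eval_le
    (hcont : ∀ᵐ x ∂volume.restrict (Ioo (0 : ℝ) 1), ∀ k, ContinuousAt (coeff a k) x)
    (hdecay : decayNorm a < ⊤) {p : Polynomial ℂ} {δ : ℝ} (hδ₀ : 0 ≤ δ) (hδ₁ : δ < 1)
    (hp : ∀ᵐ x ∂volume.restrict (Ioo (0 : ℝ) 1), ∀ θ, ‖p.eval (symbol a x θ)‖ ≤ δ)
    (hU : ∀ z ∈ U, 1 ≤ ‖p.eval z‖) : IsNegligible a U := by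
  refine isLittleO_iff.2 fun ε hε => ?_
  obtain ⟨m, hm⟩ := exists_pow_lt_of_lt_one hε (pow_lt_one₀ hδ₀ hδ₁ two_ne_zero)
  have hpm : ∀ᵐ x ∂volume.restrict (Ioo (0 : ℝ) 1), ∀ θ,
      ‖(p ^ m).eval (symbol a x θ)‖ ≤ δ ^ m := by
    filter_upwards [hp] with x hx θ
    rw [Polynomial.eval_pow, norm_pow]
    gcongr
    exact hx θ
  have hlim_lt : ∫ x in Ioo (0 : ℝ) 1, ∫ θ, ‖(p ^ m).eval (symbol a x θ)‖ ^ 2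
      ∂AddCircle.haarAddCircle < ε := by
    refine (integral_integral_norm_sq_le hpm).trans_lt ?_
    rwa [pow_right_comm]
  have hUm : ∀ z ∈ U, 1 ≤ ‖(p ^ m).eval z‖ := fun z hz => by
    rw [Polynomial.eval_pow, norm_pow]
    exact one_le_pow₀ (hU z hz)
  filter_upwards [(tendsto_mean_norm_sq_aeval_matrix hcont hdecay (p ^ m)).eventually_lt_const
    hlim_lt] with n hn
  have hn_pos : (0 : ℝ) < n + 1 := by positivity
  rw [Real.norm_natCast, Real.norm_of_nonneg hn_pos.le]
  rw [inv_mul_lt_iff₀ hn_pos, mul_comm] at hn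
  exact (countP_roots_charpoly_le (matrix a n) hUm).trans hn.le

theorem isNegligible_setOf_le_norm
    (hcont : ∀ᵐ x ∂volume.restrict (Ioo (0 : ℝ) 1), ∀ k, ContinuousAt (coeff a k) x)
    (hdecay : decayNorm a < ⊤) {R : ℝ} (hR : ∑' k, supCoeff a k < R) :
    IsNegligible a {z | R ≤ ‖z‖} := by
  have hB : 0 ≤ ∑' k, supCoeff a k := tsum_nonneg fun _ => ENNReal.toReal_nonneg
  have hR_pos : 0 < R := hB.trans_lt hR
  have heval (z : ℂ) : ‖(Polynomial.C (R⁻¹ : ℂ) * Polynomial.X).eval z‖ = ‖z‖ / R := by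
    simp [abs_of_pos hR_pos, inv_mul_eq_div]
  refine isNegligible_of_norm_eval_le hcont hdecay (p := Polynomial.C (R⁻¹ : ℂ) * Polynomial.X)
    (div_nonneg hB hR_pos.le) ((div_lt_one hR_pos).2 hR) ?_ fun z hz => ?_
  · filter_upwards [ae_restrict_mem measurableSet_Ioo] with x hx θ
    rw [heval]
    gcongr
    exact norm_symbol_apply_le hdecay (Ioo_subset_Icc_self hx) θ
  · rw [heval]
    exact (one_le_div hR_pos).2 hz

theorem exists_mem_nhds_isNegligible
    (hcont : ∀ᵐ x ∂volume.restrict (Ioo (0 : ℝ) 1), ∀ k, ContinuousAt (coeff a k) x)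
    (ha_t : ∀ x ∈ Icc (0 : ℝ) 1, MemLp (a x) 2 (volume.restrict (Icc 0 (2 * Real.pi))))
    (hdecay : decayNorm a < ⊤) {z₀ : ℂ} (hz₀ : z₀ ∉ extRange a) :
    ∃ U ∈ 𝓝 z₀, IsNegligible a U := by
  set K := Metric.closedBall (0 : ℂ) (∑' k, supCoeff a k) ∩ essRange a
  have : CompactSpace K := isCompact_iff_compactSpace.1
    ((isCompact_closedBall _ _).inter_right isClosed_essRange)
  have hunbounded : ¬ Bornology.IsBounded (connectedComponentIn Kᶜ z₀) := fun hbounded =>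
    hz₀ <| or_iff_not_imp_left.2 fun hz => ⟨hz, hbounded.subset <|
      connectedComponentIn_mono z₀ <| compl_subset_compl.2 inter_subset_right⟩
  obtain ⟨q, hq₀, hqK⟩ :=
    exists_polynomial_eval_eq_one_norm_le hunbounded (by norm_num : (0 : ℝ) < 1 / 4)
  have heval (z : ℂ) : ‖(Polynomial.C 2 * q).eval z‖ = 2 * ‖q.eval z‖ := by simp
  have hlarge : {z : ℂ | 1 ≤ ‖(Polynomial.C 2 * q).eval z‖} ∈ 𝓝 z₀ := by
    have hlim := (Polynomial.C 2 * q).continuous.norm.tendsto z₀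
    rw [heval, hq₀, norm_one, mul_one] at hlim
    exact hlim.eventually_const_le one_lt_two
  have hsmall : ∀ᵐ x ∂volume.restrict (Ioo (0 : ℝ) 1), ∀ θ,
      ‖(Polynomial.C 2 * q).eval (symbol a x θ)‖ ≤ 1 / 2 := by
    filter_upwards [ae_forall_symbol_mem_essRange ha_t hdecay, ae_restrict_mem measurableSet_Ioo]
      with x hx hx_mem θ
    have hxK : symbol a x θ ∈ K := ⟨mem_closedBall_zero_iff.2
      (norm_symbol_apply_le hdecay (Ioo_subset_Icc_self hx_mem) θ), hx θ⟩
    rw [heval]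
    linarith [hqK _ hxK]
  exact ⟨_, hlarge, isNegligible_of_norm_eval_le hcont hdecay (by norm_num) (by norm_num) hsmall
    fun _ hz => hz⟩

theorem isNegligible_of_disjoint_extRange
    (hcont : ∀ᵐ x ∂volume.restrict (Ioo (0 : ℝ) 1), ∀ k, ContinuousAt (coeff a k) x)
    (ha_t : ∀ x ∈ Icc (0 : ℝ) 1, MemLp (a x) 2 (volume.restrict (Icc 0 (2 * Real.pi))))
    (hdecay : decayNorm a < ⊤) {U : Set ℂ} (hU : IsClosed U) (hdisj : Disjoint U (extRange a)) :
    IsNegligible a U := by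
  set R := ∑' k, supCoeff a k + 1
  have hfar : IsNegligible a {z | R ≤ ‖z‖} :=
    isNegligible_setOf_le_norm hcont hdecay (lt_add_one _)
  have hnear : IsNegligible a (Metric.closedBall 0 R ∩ U) := by
    refine ((isCompact_closedBall 0 R).inter_right hU).induction_on (hfar.mono (empty_subset _))
      (fun _ _ hsub h => h.mono hsub) (fun _ _ h₁ h₂ => h₁.union h₂) fun z hz => ?_
    obtain ⟨W, hW, hWa⟩ := exists_mem_nhds_isNegligible hcont ha_t hdecay
      (hdisj.notMem_of_mem_left hz.2)
    exact ⟨W, mem_nhdsWithin_of_mem_nhds hW, hWa⟩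
  refine hnear.of_subset_union hfar fun z hz => ?_
  rcases le_total ‖z‖ R with hzR | hzR
  · exact .inl ⟨mem_closedBall_zero_iff.2 hzR, hz⟩
  · exact .inr hzR

end EigenvalueCount

end KMS

theorem mainTheorem3_general (a : ℝ → ℝ → ℂ)
    (hcont : ∀ᵐ x ∂volume.restrict (Ioo (0 : ℝ) 1), ∀ k, ContinuousAt (KMS.coeff a k) x)
    (ha_t : ∀ x ∈ Icc (0 : ℝ) 1, MemLp (a x) 2 (volume.restrict (Icc 0 (2 * Real.pi))))
    (hdecay : KMS.decayNorm a < ⊤) (V : Set ℂ) (hV : IsOpen V) (haV : KMS.extRange a ⊆ V) :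
    Tendsto (fun n : ℕ => (KMS.eigCount a V n : ℝ) / ((n : ℝ) + 1)) atTop (𝓝 1) ∧
      (fun n : ℕ => (KMS.eigCount a Vᶜ n : ℝ)) =o[atTop] (fun n : ℕ => (n : ℝ)) := by
  have hVc : KMS.IsNegligible a Vᶜ := KMS.isNegligible_of_disjoint_extRange hcont ha_t hdecay
    hV.isClosed_compl (disjoint_compl_left_iff_subset.2 haV)
  exact ⟨by simpa only [compl_compl] using hVc.tendsto_eigCount_compl_div, hVc.isLittleO_natCast⟩

theorem mainTheorem3 (a : ℝ → ℝ → ℂ)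
    (ha_x : ∀ t ∈ Icc (0 : ℝ) (2 * Real.pi), KMS.RiemannIntegrable (fun x => a x t))
    (ha_t : ∀ x ∈ Icc (0 : ℝ) 1,
      MemLp (fun t => a x t) ⊤ (volume.restrict (Icc (0 : ℝ) (2 * Real.pi))))
    (hdecay : KMS.decayNorm a < ⊤)
    (V : Set ℂ) (hV : IsOpen V) (haV : KMS.extRange a ⊆ V) :
    Tendsto (fun n : ℕ => (KMS.eigCount a V n : ℝ) / ((n : ℝ) + 1)) atTop (𝓝 1) ∧
      (fun n : ℕ => (KMS.eigCount a Vᶜ n : ℝ)) =o[atTop] (fun n : ℕ => (n : ℝ)) := by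
  have ha_t₂ : ∀ x ∈ Icc (0 : ℝ) 1, MemLp (a x) 2 (volume.restrict (Icc 0 (2 * Real.pi))) :=
    fun x hx => (ha_t x hx).mono_exponent le_top
  exact mainTheorem3_general a (KMS.ae_continuousAt_coeff ha_x ha_t₂ hdecay) ha_t₂ hdecay V hV haV
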